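/- Let $n \ge 3$ be odd, and let $Q_n$ be the $(n+1)$-dimensional real filiform nilpotent Lie algebra with basis $X_0, X_1, \dots, X_n$ and nonzero brackets (up to skew-symmetry) $$[X_0,X_i] = X_{i+1}\quad (1 \le i \le n-2), \qquad [X_i,X_{n-i}] = (-1)^i X_n \quad (1\le i\le n-1).$$ A nilsoliton metric on a nilpotent Lie algebra $\mathfrak n$ is an inner product $\langle\cdot,\cdot\rangle$ on $\mathfrak n$ whose Ricci endomorphism $\mathrm{Ric}$ is such that $\mathrm{Ric} - \beta\,\mathrm{Id}$ is a derivation of $\mathfrak n$ for some $\beta \in \mathbb R$; here, for an orthonormal basis $(E_i)$, $$\langle \mathrm{Ric}\,X, Y\rangle = -\tfrac12 \sum_i \langle [X,E_i],[Y,E_i]\rangle + \tfrac14 \sum_{i,j} \langle [E_i,E_j],X\rangle\langle [E_i,E_j],Y\rangle .$$ Then $Q_n$ admits a nilsoliton metric, and it is unique up to isometric isomorphism and scaling: if $\langle\cdot,\cdot\rangle$ and $\langle\cdot,\cdot\rangle'$ are nilsoliton metrics on $Q_n$, then there are a Lie algebra automorphism $\varphi$ of $Q_n$ and a constant $c > 0$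 with $\langle x,y\rangle' = c\,\langle \varphi x, \varphi y\rangle$ for all $x, y \in Q_n$. -/

import Mathlib

/-- The coefficient of `X_k` in `[X_i, X_j]` for the filiform Lie algebra `Q_n`, with indices
running over `0, …, n`. -/
def filiformQCoeff (n i j k : ℕ) : ℝ :=
  if i = 0 ∧ 1 ≤ j ∧ j + 2 ≤ n then (if k = j + 1 then 1 else 0)
  else if j = 0 ∧ 1 ≤ i ∧ i + 2 ≤ n then (if k = i + 1 then -1 else 0)
  else if 1 ≤ i ∧ 1 ≤ j ∧ i + j = n then (if k = n then (-1) ^ i else 0)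
  else 0

/-- The underlying vector space of the filiform Lie algebra `Q_n` (`n` odd), of dimension `n + 1`,
as coordinate vectors with respect to the basis `X_0, …, X_n`. -/
def FiliformQ (n : ℕ) (_ : Odd n) : Type := Fin (n + 1) → ℝ

namespace FiliformQ

variable {n : ℕ} {hn : Odd n}

noncomputable instance : AddCommGroup (FiliformQ n hn) :=
  inferInstanceAs (AddCommGroup (Fin (n + 1) → ℝ))

noncomputable instance : Module ℝ (FiliformQ n hn) :=
  inferInstanceAs (Module ℝ (Fin (n + 1) → ℝ))

/-- The defining basis `X_0, …, X_n` of `Q_n`. -/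
noncomputable def X (n : ℕ) (hn : Odd n) : Module.Basis (Fin (n + 1)) ℝ (FiliformQ n hn) :=
  Pi.basisFun ℝ (Fin (n + 1))

instance : Module.Finite ℝ (FiliformQ n hn) := Module.Finite.of_basis (X n hn)

/-- The bilinear bracket of `Q_n`. -/
noncomputable instance : Bracket (FiliformQ n hn) (FiliformQ n hn) where
  bracket x y := fun k : Fin (n + 1) =>
    ∑ i : Fin (n + 1), ∑ j : Fin (n + 1), filiformQCoeff n i j k * (x i * y j)

theorem bracket_apply (x y : FiliformQ n hn) (k : Fin (n + 1)) :
    (⁅x, y⁆ : FiliformQ n hn) k =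
      ∑ i : Fin (n + 1), ∑ j : Fin (n + 1), filiformQCoeff n i j k * (x i * y j) := rfl

theorem add_apply (x y : FiliformQ n hn) (k : Fin (n + 1)) : (x + y) k = x k + y k := rfl

theorem smul_apply (c : ℝ) (x : FiliformQ n hn) (k : Fin (n + 1)) : (c • x) k = c * x k := rfl

theorem zero_apply (k : Fin (n + 1)) : (0 : FiliformQ n hn) k = 0 := rfl

@[ext] theorem ext {x y : FiliformQ n hn} (h : ∀ k : Fin (n + 1), x k = y k) : x = y := funext h

theorem coeff_skew (hn : Odd n) (i j k : ℕ) :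
    filiformQCoeff n i j k = - filiformQCoeff n j i k := by
  have key : i + j = n → (-1 : ℝ) ^ i = - (-1) ^ j := by
    intro h
    rcases Nat.even_or_odd i with hi | hi
    · have hj : Odd j := by
        rw [← h] at hn; exact (Nat.odd_add'.1 hn).2 hi
      rw [hi.neg_one_pow, hj.neg_one_pow]; norm_num
    · have hj : Even j := by
        rw [← h] at hn; exact (Nat.odd_add.1 hn).1 hi
      rw [hi.neg_one_pow, hj.neg_one_pow]
  unfold filiformQCoeff
  split_ifs <;> first | omega | simp | (apply key; omega)

/-- Contraction of a function with the structure constants. -/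
theorem coeff_sum (i j : ℕ) (f : ℕ → ℝ) :
    ∑ l : Fin (n + 1), filiformQCoeff n i j l * f l =
      if i = 0 ∧ 1 ≤ j ∧ j + 2 ≤ n then f (j + 1)
      else if j = 0 ∧ 1 ≤ i ∧ i + 2 ≤ n then - f (i + 1)
      else if 1 ≤ i ∧ 1 ≤ j ∧ i + j = n then (-1) ^ i * f n
      else 0 := by
  rw [Fin.sum_univ_eq_sum_range (fun l => filiformQCoeff n i j l * f l) (n + 1)]
  unfold filiformQCoeff
  split_ifs with h1 h2 h3
  · rw [Finset.sum_eq_single (j + 1)] <;> simp +contextual; omega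
  · rw [Finset.sum_eq_single (i + 1)] <;> simp +contextual; omega
  · rw [Finset.sum_eq_single n] <;> simp +contextual
  · simp

theorem coeff_jacobi (hn : Odd n) (i j k p : ℕ) :
    ∑ l : Fin (n + 1), filiformQCoeff n j k l * filiformQCoeff n i l p =
      ∑ l : Fin (n + 1), filiformQCoeff n i j l * filiformQCoeff n l k p +
      ∑ l : Fin (n + 1), filiformQCoeff n i k l * filiformQCoeff n j l p := by
  have key : ∀ a b : ℕ, a + b + 1 = n → (-1 : ℝ) ^ a = (-1) ^ b := by
    intro a b h
    have : Even (a + b) := by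
      rw [← h] at hn; exact Nat.not_odd_iff_even.1 (fun h' => by
        obtain ⟨u, hu⟩ := hn; obtain ⟨v, hv⟩ := h'; omega)
    rcases Nat.even_or_odd a with ha | ha
    · rw [ha.neg_one_pow, ((Nat.even_add.1 this).1 ha).neg_one_pow]
    · have hb : Odd b := by
        by_contra hb
        exact (Nat.not_even_iff_odd.2 ha) ((Nat.even_add.1 this).2 (Nat.not_odd_iff_even.1 hb))
      rw [ha.neg_one_pow, hb.neg_one_pow]
  rw [coeff_sum j k (fun l => filiformQCoeff n i l p),
    coeff_sum i j (fun l => filiformQCoeff n l k p),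
    coeff_sum i k (fun l => filiformQCoeff n j l p)]
  have hn0 : n ≠ 0 := by rintro rfl; simp at hn
  have c00 : ∀ q, filiformQCoeff n 0 0 q = 0 := by intro q; simp [filiformQCoeff, hn0.symm]
  have c0 : ∀ b q, filiformQCoeff n 0 (b + 1) q =
      if b + 3 ≤ n then (if q = b + 2 then 1 else 0) else 0 := by
    intro b q; simp [filiformQCoeff, add_assoc]
  have c1 : ∀ b q, filiformQCoeff n (b + 1) 0 q =
      if b + 3 ≤ n then (if q = b + 2 then -1 else 0) else 0 := by
    intro b q; simp [filiformQCoeff, add_assoc]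
  have c2 : ∀ a b q, filiformQCoeff n (a + 1) (b + 1) q =
      if a + b + 2 = n then (if q = n then (-1) ^ (a + 1) else 0) else 0 := by
    intro a b q
    have : a + 1 + (b + 1) = a + b + 2 := by ring
    simp [filiformQCoeff, this]
  obtain ⟨N, rfl⟩ : ∃ N, n = N + 1 := ⟨n - 1, by omega⟩
  have key' : ∀ a b : ℕ, a + b = N → (-1 : ℝ) ^ a = (-1) ^ b := fun a b h => key a b (by omega)
  rcases i with _ | i <;> rcases j with _ | j <;> rcases k with _ | k <;>
    simp [c0, c1, c2]
  all_goals clear c00 c0 c1 c2 key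
  · split_ifs <;> simp
  · split_ifs <;> first | omega | simp [pow_succ]
  · split_ifs <;> simp
  · split_ifs <;> first | omega | simp [pow_succ]
  · split_ifs <;> first | omega | (simp; done) | (simp; exact key' _ _ (by omega))
  · split_ifs <;> first | omega | simp

theorem bracket_skew (x y : FiliformQ n hn) : ⁅x, y⁆ = -⁅y, x⁆ := by
  ext k
  change _ = -(⁅y, x⁆ : FiliformQ n hn) k
  rw [bracket_apply, bracket_apply, Finset.sum_comm, ← Finset.sum_neg_distrib]
  refine Finset.sum_congr rfl fun i _ => ?_
  rw [← Finset.sum_neg_distrib]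
  refine Finset.sum_congr rfl fun j _ => ?_
  rw [coeff_skew hn]; ring

theorem bracket_bracket_apply (x y z : FiliformQ n hn) (p : Fin (n + 1)) :
    (⁅x, ⁅y, z⁆⁆ : FiliformQ n hn) p =
      ∑ i : Fin (n + 1), ∑ j : Fin (n + 1), ∑ k : Fin (n + 1),
        (∑ l : Fin (n + 1), filiformQCoeff n j k l * filiformQCoeff n i l p) *
          (x i * y j * z k) := by
  simp only [bracket_apply]
  refine Finset.sum_congr rfl fun i _ => ?_
  simp only [Finset.mul_sum, Finset.sum_mul]
  rw [Finset.sum_comm]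
  refine Finset.sum_congr rfl fun j _ => ?_
  rw [Finset.sum_comm]
  refine Finset.sum_congr rfl fun k _ => ?_
  refine Finset.sum_congr rfl fun l _ => ?_
  ring

noncomputable instance : LieRing (FiliformQ n hn) where
  add_lie x y z := by
    ext k
    simp only [bracket_apply, add_apply, ← Finset.sum_add_distrib]
    exact Finset.sum_congr rfl fun i _ => Finset.sum_congr rfl fun j _ => by ring
  lie_add x y z := by
    ext k
    simp only [bracket_apply, add_apply, ← Finset.sum_add_distrib]
    exact Finset.sum_congr rfl fun i _ => Finset.sum_congr rfl fun j _ => by ring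
  lie_self x := by
    have h := bracket_skew x x
    ext k
    have hk : (⁅x, x⁆ : FiliformQ n hn) k = -(⁅x, x⁆ : FiliformQ n hn) k := congrFun h k
    rw [zero_apply]; linarith
  leibniz_lie x y z := by
    have h1 : ⁅⁅x, y⁆, z⁆ = -⁅z, ⁅x, y⁆⁆ := bracket_skew _ _
    rw [h1]
    ext p
    change _ = -(⁅z, ⁅x, y⁆⁆ : FiliformQ n hn) p + (⁅y, ⁅x, z⁆⁆ : FiliformQ n hn) p
    have hz : (⁅z, ⁅x, y⁆⁆ : FiliformQ n hn) p =
        ∑ i : Fin (n + 1), ∑ j : Fin (n + 1), ∑ k : Fin (n + 1),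
          (∑ l : Fin (n + 1), filiformQCoeff n i j l * filiformQCoeff n k l p) *
            (x i * y j * z k) := by
      rw [bracket_bracket_apply, Finset.sum_comm]
      refine Finset.sum_congr rfl fun i _ => ?_
      rw [Finset.sum_comm]
      refine Finset.sum_congr rfl fun j _ => Finset.sum_congr rfl fun k _ => ?_
      ring
    have hy : (⁅y, ⁅x, z⁆⁆ : FiliformQ n hn) p =
        ∑ i : Fin (n + 1), ∑ j : Fin (n + 1), ∑ k : Fin (n + 1),
          (∑ l : Fin (n + 1), filiformQCoeff n i k l * filiformQCoeff n j l p) *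
            (x i * y j * z k) := by
      rw [bracket_bracket_apply, Finset.sum_comm]
      refine Finset.sum_congr rfl fun i _ => Finset.sum_congr rfl fun j _ =>
        Finset.sum_congr rfl fun k _ => ?_
      ring
    rw [hz, hy, bracket_bracket_apply, ← Finset.sum_neg_distrib, ← Finset.sum_add_distrib]
    refine Finset.sum_congr rfl fun i _ => ?_
    rw [← Finset.sum_neg_distrib, ← Finset.sum_add_distrib]
    refine Finset.sum_congr rfl fun j _ => ?_
    rw [← Finset.sum_neg_distrib, ← Finset.sum_add_distrib]
    refine Finset.sum_congr rfl fun k _ => ?_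
    rw [coeff_jacobi hn]
    have : ∑ l : Fin (n + 1), filiformQCoeff n i j l * filiformQCoeff n l k p =
        -∑ l : Fin (n + 1), filiformQCoeff n i j l * filiformQCoeff n k l p := by
      rw [← Finset.sum_neg_distrib]
      refine Finset.sum_congr rfl fun l _ => ?_
      rw [coeff_skew hn l k]; ring
    rw [this]; ring

noncomputable instance : LieAlgebra ℝ (FiliformQ n hn) where
  lie_smul t x y := by
    ext k
    rw [smul_apply]
    simp only [bracket_apply, smul_apply, Finset.mul_sum]
    exact Finset.sum_congr rfl fun i _ => Finset.sum_congr rfl fun j _ => by ring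

/-- The structure constants of `Q_n` with respect to `X_0, …, X_n`. -/
theorem X_repr_lie (i j k : Fin (n + 1)) :
    (X n hn).repr ⁅X n hn i, X n hn j⁆ k = filiformQCoeff n i j k := by
  change (⁅X n hn i, X n hn j⁆ : FiliformQ n hn) k = _
  have hX : ∀ a b : Fin (n + 1), (X n hn a) b = if b = a then (1 : ℝ) else 0 := by
    intro a b
    change (Pi.basisFun ℝ (Fin (n + 1)) a) b = _
    simp [Pi.single_apply]
  rw [bracket_apply]
  simp [hX]

end FiliformQ

section Nilsoliton

variable {L : Type*} [LieRing L] [LieAlgebra ℝ L]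

/-- `Q` is an inner product on `L` (equivalently, a left-invariant Riemannian metric on the simply
connected Lie group of `L`). -/
structure IsInnerProduct (Q : LinearMap.BilinForm ℝ L) : Prop where
  symm : ∀ x y, Q x y = Q y x
  pos : ∀ x, x ≠ 0 → 0 < Q x x

/-- The basis `b` is `Q`-orthonormal. -/
def IsOrthonormalBasis {ι : Type*} [DecidableEq ι] (Q : LinearMap.BilinForm ℝ L)
    (b : Module.Basis ι ℝ L) : Prop :=
  ∀ i j, Q (b i) (b j) = if i = j then 1 else 0

/-- The nil-Ricci form of `(L, Q)`, computed in a basis `b`, which is to be orthonormal: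
`ric(x, y) = -1/2 ∑ i, ⟨[x, b i], [y, b i]⟩ + 1/4 ∑ i j, ⟨[b i, b j], x⟩ ⟨[b i, b j], y⟩`.
For nilpotent `L` it is the Ricci form of the left-invariant metric `Q`. -/
noncomputable def nilRicciForm {ι : Type*} [Fintype ι] (Q : LinearMap.BilinForm ℝ L)
    (b : Module.Basis ι ℝ L) (x y : L) : ℝ :=
  -(1 / 2) * ∑ i, Q ⁅x, b i⁆ ⁅y, b i⁆ +
    (1 / 4) * ∑ i, ∑ j, Q ⁅b i, b j⁆ x * Q ⁅b i, b j⁆ y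

/-- `R` is the nil-Ricci endomorphism of `(L, Q)`: `⟨R x, y⟩ = ric(x, y)`, where `ric` is computed
in a `Q`-orthonormal basis. The choice of that basis is immaterial, by
`nilRicciForm_eq_of_isOrthonormalBasis`. -/
def IsNilRicciEndomorphism (Q : LinearMap.BilinForm ℝ L) (R : L →ₗ[ℝ] L) : Prop :=
  ∃ b : Module.Basis (Fin (Module.finrank ℝ L)) ℝ L, IsOrthonormalBasis Q b ∧
    ∀ x y, Q (R x) y = nilRicciForm Q b x y

/-- `Q` is a nilsoliton metric on the nilpotent Lie algebra `L`: it is an inner product whose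
Ricci endomorphism is a scalar multiple `β` of the identity plus a derivation of `L`. -/
def IsNilsolitonMetric (Q : LinearMap.BilinForm ℝ L) : Prop :=
  IsInnerProduct Q ∧ ∃ (β : ℝ) (D : LieDerivation ℝ L L),
    IsNilRicciEndomorphism Q (β • LinearMap.id + D.toLinearMap)

theorem sum_diag_eq_of_isOrthonormalBasis {ι κ : Type*} [Fintype ι] [DecidableEq ι]
    [Fintype κ] [DecidableEq κ] {Q : LinearMap.BilinForm ℝ L}
    {b : Module.Basis ι ℝ L} {c : Module.Basis κ ℝ L}
    (hb : IsOrthonormalBasis Q b) (hc : IsOrthonormalBasis Q c)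
    (G : LinearMap.BilinForm ℝ L) : ∑ i, G (b i) (b i) = ∑ j, G (c j) (c j) := by
  have hrepr : ∀ x : L, x = ∑ j, Q (c j) x • c j := by
    intro x
    have h : ∀ j, Q (c j) x = c.repr x j := by
      intro j
      conv_lhs => rw [← c.sum_repr x]
      simp [hc j, -Module.Basis.sum_repr]
    simp only [h, c.sum_repr]
  have hrepr' : ∀ x : L, x = ∑ i, Q x (b i) • b i := by
    intro x
    have h : ∀ j, Q x (b j) = b.repr x j := by
      intro j
      conv_lhs => rw [← b.sum_repr x]
      simp [hb _ j, -Module.Basis.sum_repr]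
    simp only [h, b.sum_repr]
  have h1 : ∀ i, G (b i) (b i) = ∑ j, Q (c j) (b i) * G (c j) (b i) := by
    intro i
    conv_lhs => rw [show G (b i) (b i) = G.flip (b i) (b i) from rfl]
    conv_lhs => arg 2; rw [hrepr (b i)]
    simp
  have h2 : ∀ j, G (c j) (c j) = ∑ i, Q (c j) (b i) * G (c j) (b i) := by
    intro j
    conv_lhs => arg 2; rw [hrepr' (c j)]
    simp
  simp only [h1, h2]
  exact Finset.sum_comm

/-- The nil-Ricci form does not depend on the orthonormal basis. -/
theorem nilRicciForm_eq_of_isOrthonormalBasis {ι κ : Type*} [Fintype ι] [DecidableEq ι]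
    [Fintype κ] [DecidableEq κ] {Q : LinearMap.BilinForm ℝ L}
    {b : Module.Basis ι ℝ L} {c : Module.Basis κ ℝ L}
    (hb : IsOrthonormalBasis Q b) (hc : IsOrthonormalBasis Q c) (x y : L) :
    nilRicciForm Q b x y = nilRicciForm Q c x y := by
  let ad : L → (L →ₗ[ℝ] L) := fun u => (LieAlgebra.ad ℝ L u : L →ₗ[ℝ] L)
  have h1 : ∑ i, Q ⁅x, b i⁆ ⁅y, b i⁆ = ∑ j, Q ⁅x, c j⁆ ⁅y, c j⁆ :=
    sum_diag_eq_of_isOrthonormalBasis hb hc (Q.compl₁₂ (ad x) (ad y))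
  have h2 : ∀ u : L, ∑ j, Q ⁅u, b j⁆ x * Q ⁅u, b j⁆ y = ∑ j, Q ⁅u, c j⁆ x * Q ⁅u, c j⁆ y := by
    intro u
    exact sum_diag_eq_of_isOrthonormalBasis hb hc
      ((LinearMap.mul ℝ ℝ).compl₁₂ (Q.flip x ∘ₗ ad u) (Q.flip y ∘ₗ ad u))
  have h3 : ∀ v : L, ∑ i, Q ⁅b i, v⁆ x * Q ⁅b i, v⁆ y = ∑ i, Q ⁅c i, v⁆ x * Q ⁅c i, v⁆ y := by
    intro v
    have h := sum_diag_eq_of_isOrthonormalBasis hb hc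
      ((LinearMap.mul ℝ ℝ).compl₁₂ (Q.flip x ∘ₗ ad v) (Q.flip y ∘ₗ ad v))
    have e : ∀ w : L, Q ⁅w, v⁆ x * Q ⁅w, v⁆ y = Q ⁅v, w⁆ x * Q ⁅v, w⁆ y := by
      intro w
      rw [← lie_skew v w]; simp only [map_neg, LinearMap.neg_apply, neg_mul_neg]
    simp only [e]
    exact h
  unfold nilRicciForm
  rw [h1]
  congr 2
  simp only [h2]
  rw [Finset.sum_comm]
  simp only [h3]
  rw [Finset.sum_comm]

end Nilsoliton

/-! Existence is a computation with an explicit diagonal metric, `modelMetric`. Uniqueness rests on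
the pre-Einstein derivation of `Q_n`: the diagonal derivation with weights `ω = filiformWeight n`,
for which `tr(ω ψ) = γ tr ψ` for every diagonal derivation `ψ` (`IsFiliformWeight.sum_weight_mul`).
Its weights are positive and distinct, every derivation preserves the filtration they define
(`derivation_repr_eq_zero_of_weight_lt`), and a weight is the sum of two distinct others only where
a bracket says so (`FiliformTriple.of_weight_eq`).

Let `Ric = β + D` for a nilsoliton metric. Gram–Schmidt along the filtration gives an orthonormal
basis `E` in which `D` is triangular and symmetric, hence diagonal, with eigenvalues `δ`. For
diagonal `ψ`, `tr(Ric ψ)` is a quarter of the sum of the squared structure constants times `ψ k - ψ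
i - ψ j` (`sum_mul_nilRicciForm`). This is zero for `ψ = δ`, and nonnegative for `ψ = ω` because
brackets in `E` respect the filtration. With `θ = -β / γ` the pre-Einstein identities give `∑ (δ - θ
ω)² = -θ tr(Ric ω)`. So both sides vanish: `δ = θ ω`, and all structure constants in `E` are
homogeneous for `ω` (`IsOrthonormalBasis.weights_eq_smul`). Hence `E` has brackets of the shape of
`Q_n`, with unknown constants `c j`, `d i`.

The diagonal Ricci equations and the Jacobi identity determine these up to sign and the scale `θ`: a
discrete maximum principle makes the `d i ^ 2` equal (`filiform_const_of_recurrence`), and the `c j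
^ 2` follow (`filiform_eq_of_recurrence`). Rescaling `E` produces a basis with exactly the brackets
of the `X_i`, orthogonal with lengths proportional to those of the model, so the metric is a
multiple of the model up to an automorphism (`exists_lieEquiv_modelMetric`). -/

/-! ### Orthonormal bases and the Ricci form in structure constants. -/

section OrthonormalBasis

/-- Gram–Schmidt: an inner product has an orthonormal basis that is triangular with respect to a
given basis, for the order defined by an injective weight function. -/
theorem exists_orthonormal_basis_triangular {V ι : Type*} [AddCommGroup V] [Module ℝ V]
    [Fintype ι] [DecidableEq ι] (Q : LinearMap.BilinForm ℝ V) (hs : ∀ x y, Q x y = Q y x)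
    (hp : ∀ x, x ≠ 0 → 0 < Q x x) (X : Module.Basis ι ℝ V) (ω : ι → ℝ)
    (hω : Function.Injective ω) :
    ∃ E : Module.Basis ι ℝ V, (∀ i j, Q (E i) (E j) = if i = j then 1 else 0) ∧
      (∀ i j, ω j < ω i → X.repr (E i) j = 0) ∧ (∀ i j, ω j < ω i → E.repr (X i) j = 0) := by
  let core : InnerProductSpace.Core ℝ V :=
    { inner := fun x y => Q x y
      conj_inner_symm := fun x y => by simpa using hs y x
      re_inner_nonneg := fun x => by
        rcases eq_or_ne x 0 with rfl | hx
        · simp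
        · simpa using (hp x hx).le
      add_left := fun x y z => by simp
      smul_left := fun x y r => by simp
      definite := fun x hx => by
        by_contra h
        exact (hp x h).ne' hx }
  let : NormedAddCommGroup V := core.toNormedAddCommGroup
  let : InnerProductSpace ℝ V := InnerProductSpace.ofCore core.toCore
  have hin : ∀ x y : V, inner ℝ x y = Q x y := fun _ _ => rfl
  have : FiniteDimensional ℝ V := Module.Finite.of_basis X
  -- Gram–Schmidt builds `E i` from the `X j` with `j ≤ i`. The sign makes these the vectors of
  -- weight at least `ω i`.
  let : LinearOrder ι := LinearOrder.lift' (fun i => -ω i) (neg_injective.comp hω)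
  have hlt : ∀ i j : ι, i < j ↔ ω j < ω i := fun i j =>
    (neg_lt_neg_iff : -ω i < -ω j ↔ ω j < ω i)
  let : LocallyFiniteOrderBot ι := LocallyFiniteOrderBot.ofIic ι
    (fun a => Finset.univ.filter (· ≤ a)) (by simp)
  have hcard := Module.finrank_eq_card_basis X
  let F := InnerProductSpace.gramSchmidtOrthonormalBasis hcard X
  have hF : ∀ i, F i = InnerProductSpace.gramSchmidtNormed ℝ X i := fun i =>
    InnerProductSpace.gramSchmidtOrthonormalBasis_apply hcard (by
      intro h
      have := InnerProductSpace.gramSchmidtNormed_unit_length (𝕜 := ℝ) i X.linearIndependent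
      rw [h, norm_zero] at this
      exact zero_ne_one this)
  refine ⟨F.toBasis, fun i j => ?_, fun i j hij => ?_, fun i j hij => ?_⟩
  · rw [← hin, OrthonormalBasis.coe_toBasis]
    have := orthonormal_iff_ite.1 F.orthonormal i j
    rw [this]
  · rw [OrthonormalBasis.coe_toBasis, hF]
    have hm : InnerProductSpace.gramSchmidtNormed ℝ X i ∈ Submodule.span ℝ (X '' Set.Iic i) := by
      rw [← InnerProductSpace.span_gramSchmidt_Iic ℝ X i,
        ← InnerProductSpace.span_gramSchmidtNormed]
      exact Submodule.subset_span ⟨i, Set.mem_Iic.2 le_rfl, rfl⟩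
    rw [Module.Basis.mem_span_image] at hm
    by_contra h
    have : j ≤ i := hm (Finsupp.mem_support_iff.2 h)
    exact absurd this (not_le.2 ((hlt i j).2 hij))
  · have := InnerProductSpace.gramSchmidtOrthonormalBasis_inv_triangular hcard X ((hlt i j).2 hij)
    rw [← this, OrthonormalBasis.coe_toBasis_repr_apply, OrthonormalBasis.repr_apply_apply]

variable {L : Type*} [LieRing L] [LieAlgebra ℝ L] {ι : Type*} [Fintype ι] [DecidableEq ι]
  {Q : LinearMap.BilinForm ℝ L} {b : Module.Basis ι ℝ L}

theorem IsOrthonormalBasis.repr_eq (hb : IsOrthonormalBasis Q b) (x : L) (i : ι) :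
    b.repr x i = Q x (b i) := by
  conv_rhs => rw [← b.sum_repr x]
  simp [hb _ i, -Module.Basis.sum_repr]

theorem IsOrthonormalBasis.apply_eq_sum (hb : IsOrthonormalBasis Q b) (x y : L) :
    Q x y = ∑ i, Q x (b i) * Q y (b i) := by
  conv_lhs => rw [← b.sum_repr y]
  simp only [map_sum, map_smul, smul_eq_mul, hb.repr_eq]
  exact Finset.sum_congr rfl fun i _ => mul_comm _ _

theorem IsOrthonormalBasis.symm (hb : IsOrthonormalBasis Q b) (x y : L) : Q x y = Q y x := by
  rw [hb.apply_eq_sum, hb.apply_eq_sum y]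
  exact Finset.sum_congr rfl fun i _ => mul_comm _ _

theorem IsOrthonormalBasis.ext_right (hb : IsOrthonormalBasis Q b) {x y : L}
    (h : ∀ i, Q x (b i) = Q y (b i)) : x = y :=
  b.ext_elem fun i => by rw [hb.repr_eq, hb.repr_eq, h]

omit [DecidableEq ι] in
theorem nilRicciForm_symm (Q : LinearMap.BilinForm ℝ L) (hQ : ∀ x y, Q x y = Q y x)
    (b : Module.Basis ι ℝ L) (x y : L) : nilRicciForm Q b x y = nilRicciForm Q b y x := by
  unfold nilRicciForm
  simp only [hQ ⁅x, _⁆ ⁅y, _⁆, mul_comm (Q _ x)]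

/-- The nil-Ricci form as a bilinear form. -/
noncomputable def nilRicciBilin (Q : LinearMap.BilinForm ℝ L) (b : Module.Basis ι ℝ L) :
    LinearMap.BilinForm ℝ L :=
  LinearMap.mk₂ ℝ (nilRicciForm Q b)
    (fun x x' y => by
      simp only [nilRicciForm, add_lie, map_add, LinearMap.add_apply, add_mul,
        Finset.sum_add_distrib, mul_add]
      ring)
    (fun c x y => by
      simp only [nilRicciForm, smul_lie, map_smul, LinearMap.smul_apply, smul_eq_mul, mul_assoc,
        ← Finset.mul_sum, mul_add]
      ring)
    (fun x y y' => by
      simp only [nilRicciForm, add_lie, map_add, mul_add,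
        Finset.sum_add_distrib]
      ring)
    (fun c x y => by
      simp only [nilRicciForm, smul_lie, map_smul, smul_eq_mul, mul_left_comm _ c,
        ← Finset.mul_sum, mul_add])

/-- The nil-Ricci form in terms of the structure constants. -/
theorem nilRicciForm_basis (hb : IsOrthonormalBasis Q b) (p q : ι) :
    nilRicciForm Q b (b p) (b q) =
      -(1 / 2) * ∑ i, ∑ l, Q ⁅b p, b i⁆ (b l) * Q ⁅b q, b i⁆ (b l) +
        (1 / 4) * ∑ i, ∑ j, Q ⁅b i, b j⁆ (b p) * Q ⁅b i, b j⁆ (b q) := by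
  unfold nilRicciForm
  simp only [fun i => hb.apply_eq_sum ⁅b p, b i⁆ ⁅b q, b i⁆]

/-- Pairing the nil-Ricci form with a diagonal endomorphism. -/
theorem sum_mul_nilRicciForm (hb : IsOrthonormalBasis Q b) (ψ : ι → ℝ) :
    ∑ p, ψ p * nilRicciForm Q b (b p) (b p) =
      (1 / 4) * ∑ i, ∑ j, ∑ k, Q ⁅b i, b j⁆ (b k) ^ 2 * (ψ k - ψ i - ψ j) := by
  have hsk : ∀ i j k, Q ⁅b i, b j⁆ (b k) ^ 2 = Q ⁅b j, b i⁆ (b k) ^ 2 := by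
    intro i j k
    rw [← lie_skew (b i) (b j), map_neg, LinearMap.neg_apply, neg_sq]
  -- By skew-symmetry `ψ i` and `ψ j` contribute equally, so the `-1/2` term of the Ricci form
  -- splits as `-1/4` of each.
  have e1 : ∑ i, ∑ j, ∑ k, Q ⁅b i, b j⁆ (b k) ^ 2 * ψ j =
      ∑ i, ∑ j, ∑ k, Q ⁅b i, b j⁆ (b k) ^ 2 * ψ i := by
    rw [Finset.sum_comm]
    simp only [fun i j k => hsk j i k]
  have e2 : ∑ i, ∑ j, ∑ k, Q ⁅b i, b j⁆ (b k) ^ 2 * ψ k =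
      ∑ k, ψ k * ∑ i, ∑ j, Q ⁅b i, b j⁆ (b k) ^ 2 := by
    simp only [Finset.mul_sum]
    rw [Finset.sum_comm' (t' := Finset.univ) (s' := fun _ => Finset.univ) (by simp)]
    simp only [fun j => Finset.sum_comm (s := Finset.univ) (t := Finset.univ)
      (f := fun i k => Q ⁅b i, b j⁆ (b k) ^ 2 * ψ k)]
    rw [Finset.sum_comm]
    refine Finset.sum_congr rfl fun k _ => ?_
    rw [Finset.sum_comm]
    exact Finset.sum_congr rfl fun i _ => Finset.sum_congr rfl fun j _ => mul_comm _ _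
  have e3 : ∑ i, ∑ j, ∑ k, Q ⁅b i, b j⁆ (b k) ^ 2 * ψ i =
      ∑ i, ψ i * ∑ j, ∑ k, Q ⁅b i, b j⁆ (b k) ^ 2 := by
    simp only [Finset.mul_sum]
    exact Finset.sum_congr rfl fun k _ => Finset.sum_congr rfl fun i _ =>
      Finset.sum_congr rfl fun j _ => mul_comm _ _
  simp only [mul_sub, Finset.sum_sub_distrib]
  rw [e1, e2, e3]
  simp only [nilRicciForm_basis hb, ← pow_two, mul_add, Finset.sum_add_distrib]
  simp only [mul_left_comm (ψ _), ← Finset.mul_sum]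
  ring

end OrthonormalBasis

/-! ### Weight filtrations and rigidity of the soliton derivation. -/

section Graded

variable {L : Type*} [LieRing L] [LieAlgebra ℝ L] {ι : Type*} [Fintype ι]

theorem repr_lie_eq_sum (X : Module.Basis ι ℝ L) (x y : L) (k : ι) :
    X.repr ⁅x, y⁆ k = ∑ a, ∑ c, X.repr x a * X.repr y c * X.repr ⁅X a, X c⁆ k := by
  conv_lhs => rw [← X.sum_repr x, ← X.sum_repr y]
  simp only [sum_lie, lie_sum, smul_lie, lie_smul, map_sum, map_smul,
    Finsupp.finsetSum_apply, Finsupp.smul_apply, smul_eq_mul, mul_assoc]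
  rw [Finset.sum_comm]
  exact Finset.sum_congr rfl fun _ _ => by
    rw [Finset.mul_sum]
    exact Finset.sum_congr rfl fun _ _ => by ring

theorem repr_map_eq_sum {V : Type*} [AddCommGroup V] [Module ℝ V] (X E : Module.Basis ι ℝ V)
    (D : V →ₗ[ℝ] V) (z : V) (l : ι) :
    E.repr (D z) l = ∑ a, X.repr z a * E.repr (D (X a)) l := by
  conv_lhs => rw [← X.sum_repr z]
  simp only [map_sum, map_smul, Finsupp.finsetSum_apply, Finsupp.smul_apply, smul_eq_mul]

theorem repr_eq_sum {V : Type*} [AddCommGroup V] [Module ℝ V] (X E : Module.Basis ι ℝ V)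
    (z : V) (l : ι) : E.repr z l = ∑ a, X.repr z a * E.repr (X a) l :=
  repr_map_eq_sum X E LinearMap.id z l

variable {X E : Module.Basis ι ℝ L} {ω : ι → ℝ}

/-- Each `E i` is a combination of vectors `X a` with `ω i ≤ ω a`, and brackets of the `X a` add
weights. -/
theorem repr_lie_eq_zero_of_lt
    (hX : ∀ i j k, X.repr ⁅X i, X j⁆ k ≠ 0 → ω k = ω i + ω j)
    (h1 : ∀ i j, ω j < ω i → X.repr (E i) j = 0) {i j k : ι} (h : ω k < ω i + ω j) :
    X.repr ⁅E i, E j⁆ k = 0 := by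
  rw [repr_lie_eq_sum]
  refine Finset.sum_eq_zero fun a _ => Finset.sum_eq_zero fun c _ => ?_
  by_contra hne
  have ha : ω i ≤ ω a := not_lt.1 fun h' => hne (by rw [h1 i a h']; ring)
  have hc : ω j ≤ ω c := not_lt.1 fun h' => hne (by rw [h1 j c h']; ring)
  have := hX a c k (right_ne_zero_of_mul hne)
  linarith

/-- Structure constants in a triangular basis respect the filtration. -/
theorem le_of_repr_lie_ne_zero
    (hX : ∀ i j k, X.repr ⁅X i, X j⁆ k ≠ 0 → ω k = ω i + ω j)
    (h1 : ∀ i j, ω j < ω i → X.repr (E i) j = 0) (h2 : ∀ i j, ω j < ω i → E.repr (X i) j = 0)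
    {i j k : ι} (h : E.repr ⁅E i, E j⁆ k ≠ 0) : ω i + ω j ≤ ω k := by
  by_contra hlt
  rw [not_le] at hlt
  apply h
  rw [repr_eq_sum X E]
  refine Finset.sum_eq_zero fun a _ => ?_
  rcases lt_or_ge (ω a) (ω i + ω j) with ha | ha
  · rw [repr_lie_eq_zero_of_lt hX h1 ha, zero_mul]
  · rw [h2 a k (hlt.trans_le ha), mul_zero]

/-- The two transition matrices are mutually inverse and triangular for the same strict order, so
their diagonal entries multiply to `1`. -/
theorem repr_diag_ne_zero (hω : Function.Injective ω)
    (h1 : ∀ i j, ω j < ω i → X.repr (E i) j = 0) (h2 : ∀ i j, ω j < ω i → E.repr (X i) j = 0)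
    (k : ι) : X.repr (E k) k ≠ 0 := by
  intro h
  have h3 : E.repr (E k) k = ∑ a, X.repr (E k) a * E.repr (X a) k := repr_eq_sum X E _ _
  rw [Finset.sum_eq_zero, Module.Basis.repr_self, Finsupp.single_eq_same] at h3
  · exact one_ne_zero h3
  · intro a _
    rcases lt_trichotomy (ω a) (ω k) with ha | ha | ha
    · rw [h1 k a ha, zero_mul]
    · rw [hω ha, h, zero_mul]
    · rw [h2 a k ha, mul_zero]

/-- Leading structure constants survive in a triangular basis. -/
theorem repr_lie_ne_zero (hω : Function.Injective ω)
    (hX : ∀ i j k, X.repr ⁅X i, X j⁆ k ≠ 0 → ω k = ω i + ω j)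
    (h1 : ∀ i j, ω j < ω i → X.repr (E i) j = 0) (h2 : ∀ i j, ω j < ω i → E.repr (X i) j = 0)
    {i j k : ι} (h : X.repr ⁅X i, X j⁆ k ≠ 0) : E.repr ⁅E i, E j⁆ k ≠ 0 := by
  have hk := hX i j k h
  -- The weight `ω i + ω j` is the lowest that can occur, and injectivity of `ω` leaves only the
  -- product of the diagonal terms there.
  have e1 : X.repr ⁅E i, E j⁆ k = X.repr (E i) i * X.repr (E j) j * X.repr ⁅X i, X j⁆ k := by
    rw [repr_lie_eq_sum, Finset.sum_eq_single i, Finset.sum_eq_single j]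
    · intro c _ hc
      by_contra hne
      have hc' : ω j ≤ ω c := not_lt.1 fun h' => hne (by rw [h1 j c h']; ring)
      have := hX i c k (right_ne_zero_of_mul hne)
      exact hc (hω (by linarith))
    · simp
    · intro a _ hai
      refine Finset.sum_eq_zero fun c _ => ?_
      by_contra hne
      have ha : ω i ≤ ω a := not_lt.1 fun h' => hne (by rw [h1 i a h']; ring)
      have hc : ω j ≤ ω c := not_lt.1 fun h' => hne (by rw [h1 j c h']; ring)
      have := hX a c k (right_ne_zero_of_mul hne)
      exact hai (hω (by linarith))
    · simp
  have e2 : X.repr ⁅E i, E j⁆ k = E.repr ⁅E i, E j⁆ k * X.repr (E k) k := by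
    rw [repr_eq_sum E X, Finset.sum_eq_single k]
    · intro l _ hl
      by_contra hne
      have h3 := le_of_repr_lie_ne_zero hX h1 h2 (left_ne_zero_of_mul hne)
      have h4 : ω l ≤ ω k := not_lt.1 fun h' => hne (by rw [h1 l k h', mul_zero])
      exact hl (hω (by linarith))
    · simp
  intro h0
  rw [h0, zero_mul, e1] at e2
  exact mul_ne_zero (mul_ne_zero (repr_diag_ne_zero hω h1 h2 i) (repr_diag_ne_zero hω h1 h2 j)) h e2

variable [DecidableEq ι] {Q : LinearMap.BilinForm ℝ L}

/-- A symmetric endomorphism preserving the filtration is diagonal in a triangular orthonormal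
basis. -/
theorem IsOrthonormalBasis.exists_eigenvalues (hE : IsOrthonormalBasis Q E)
    (hω : Function.Injective ω)
    (h1 : ∀ i j, ω j < ω i → X.repr (E i) j = 0) (h2 : ∀ i j, ω j < ω i → E.repr (X i) j = 0)
    {D : L →ₗ[ℝ] L} (hD : ∀ x y, Q (D x) y = Q x (D y))
    (hDX : ∀ k j, ω j < ω k → X.repr (D (X k)) j = 0) :
    ∃ δ : ι → ℝ, ∀ k, D (E k) = δ k • E k := by
  have hlt : ∀ k j, ω j < ω k → Q (D (E k)) (E j) = 0 := by
    intro k j hjk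
    rw [← hE.repr_eq, repr_map_eq_sum X E]
    refine Finset.sum_eq_zero fun a _ => ?_
    rcases lt_or_ge (ω a) (ω k) with ha | ha
    · rw [h1 k a ha, zero_mul]
    · rw [repr_eq_sum X E, Finset.sum_eq_zero, mul_zero]
      intro c _
      rcases lt_or_ge (ω c) (ω a) with hc | hc
      · rw [hDX a c hc, zero_mul]
      · rw [h2 c j (hjk.trans_le (ha.trans hc)), mul_zero]
  refine ⟨fun k => Q (D (E k)) (E k), fun k => hE.ext_right fun j => ?_⟩
  rw [map_smul, LinearMap.smul_apply, hE k j, smul_eq_mul]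
  -- Entries of lower weight vanish by triangularity, those of higher weight by symmetry of `D`.
  rcases lt_trichotomy (ω j) (ω k) with h | h | h
  · rw [if_neg (by rintro rfl; exact lt_irrefl _ h), hlt k j h, mul_zero]
  · rw [hω h, if_pos rfl, mul_one]
  · rw [if_neg (by rintro rfl; exact lt_irrefl _ h), mul_zero, hD, hE.symm, hlt j k h]

/-- Let an orthonormal basis diagonalize the nil-Ricci form with eigenvalues `β + δ k`, where the
structure constants are homogeneous for the weights `δ` and filtered for the weights `ω`. If `ω`
satisfies the pre-Einstein identities on `ω` and `δ`, then `δ` is a multiple of `ω` and the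
structure constants are homogeneous for `ω`. -/
theorem IsOrthonormalBasis.weights_eq_smul (hE : IsOrthonormalBasis Q E) {δ : ι → ℝ} {β γ : ℝ}
    (hric : ∀ k, nilRicciForm Q E (E k) (E k) = β + δ k)
    (hδ : ∀ i j k, Q ⁅E i, E j⁆ (E k) ≠ 0 → δ k = δ i + δ j)
    (hω : ∀ i j k, Q ⁅E i, E j⁆ (E k) ≠ 0 → ω i + ω j ≤ ω k)
    (hne : ∃ i j k, Q ⁅E i, E j⁆ (E k) ≠ 0) (hγ : 0 < γ)
    (hωδ : ∑ k, ω k * δ k = γ * ∑ k, δ k) (hωω : ∑ k, ω k * ω k = γ * ∑ k, ω k) :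
    ∃ θ : ℝ, 0 < θ ∧ β = -(θ * γ) ∧ (∀ k, δ k = θ * ω k) ∧
      ∀ i j k, Q ⁅E i, E j⁆ (E k) ≠ 0 → ω k = ω i + ω j := by
  have key := sum_mul_nilRicciForm hE
  simp only [hric] at key
  -- The Ricci endomorphism is trace-orthogonal to the derivation `δ`.
  have kδ : ∑ k, δ k * (β + δ k) = 0 := by
    rw [key δ]
    refine mul_eq_zero_of_right _ (Finset.sum_eq_zero fun i _ => Finset.sum_eq_zero fun j _ =>
      Finset.sum_eq_zero fun k _ => ?_)
    by_cases h : Q ⁅E i, E j⁆ (E k) = 0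
    · rw [h]; ring
    · rw [hδ i j k h]; ring
  have ω0 : ∀ i j k, 0 ≤ Q ⁅E i, E j⁆ (E k) ^ 2 * (ω k - ω i - ω j) := by
    intro i j k
    by_cases h : Q ⁅E i, E j⁆ (E k) = 0
    · rw [h]; simp
    · exact mul_nonneg (sq_nonneg _) (by linarith [hω i j k h])
  have kω := key ω
  -- Pairing with the identity: the trace of Ricci is negative because some bracket is nonzero.
  have k1 : ∑ k, (β + δ k) < 0 := by
    have := key fun _ => 1
    simp only [one_mul] at this
    rw [this]
    obtain ⟨i, j, k, h⟩ := hne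
    have hpos : 0 < ∑ i, ∑ j, ∑ k, Q ⁅E i, E j⁆ (E k) ^ 2 := by
      refine Finset.sum_pos' (fun _ _ => Finset.sum_nonneg fun _ _ => Finset.sum_nonneg
        fun _ _ => sq_nonneg _) ⟨i, Finset.mem_univ _, ?_⟩
      refine Finset.sum_pos' (fun _ _ => Finset.sum_nonneg
        fun _ _ => sq_nonneg _) ⟨j, Finset.mem_univ _, ?_⟩
      exact Finset.sum_pos' (fun _ _ => sq_nonneg _) ⟨k, Finset.mem_univ _, by positivity⟩
    have e : ∀ i j k, Q ⁅E i, E j⁆ (E k) ^ 2 * ((1 : ℝ) - 1 - 1) = -Q ⁅E i, E j⁆ (E k) ^ 2 :=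
      fun _ _ _ => by ring
    simp only [e, Finset.sum_neg_distrib]
    linarith
  have ksq : ∑ k, (β + δ k) ^ 2 = β * ∑ k, (β + δ k) := by
    rw [← add_zero (β * _), ← kδ, Finset.mul_sum, ← Finset.sum_add_distrib]
    exact Finset.sum_congr rfl fun k _ => by ring
  have hβ : β < 0 := by
    have h0 : 0 ≤ ∑ k, (β + δ k) ^ 2 := Finset.sum_nonneg fun _ _ => sq_nonneg _
    rcases lt_trichotomy β 0 with h | h | h
    · exact h
    · subst h
      rw [zero_mul] at ksq
      have := (Finset.sum_eq_zero_iff_of_nonneg fun _ _ => sq_nonneg _).1 ksq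
      rw [Finset.sum_eq_zero fun k hk => pow_eq_zero_iff two_ne_zero |>.1 (this k hk)] at k1
      exact absurd k1 (lt_irrefl _)
    · nlinarith
  set θ := -β / γ with hθ
  have hθ0 : 0 < θ := div_pos (by linarith) hγ
  have hβθ : β = -(θ * γ) := by rw [hθ]; field_simp
  -- Expanding the square, `kδ` and `hωδ` turn `∑ δ²` into `θ ∑ ω δ`, and `hωω` reduces `∑ ω²` to a
  -- trace. The choice `β = -θ γ` makes the remainder a multiple of `tr(Ric ω)`.
  have hsum : ∑ k, (δ k - θ * ω k) ^ 2 = -θ * ∑ k, ω k * (β + δ k) := by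
    have a1 : ∑ k, (δ k - θ * ω k) ^ 2 =
        ∑ k, δ k * (β + δ k) - β * ∑ k, δ k - 2 * θ * ∑ k, ω k * δ k
          + θ ^ 2 * ∑ k, ω k * ω k := by
      simp only [Finset.mul_sum, ← Finset.sum_sub_distrib, ← Finset.sum_add_distrib]
      exact Finset.sum_congr rfl fun k _ => by ring
    have a2 : ∑ k, ω k * (β + δ k) = β * ∑ k, ω k + ∑ k, ω k * δ k := by
      simp only [Finset.mul_sum, ← Finset.sum_add_distrib]
      exact Finset.sum_congr rfl fun k _ => by ring
    rw [a1, a2, kδ, hωδ, hωω, hβθ]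
    ring
  have hnn : 0 ≤ ∑ k, ω k * (β + δ k) := by
    rw [kω]
    exact mul_nonneg (by norm_num) (Finset.sum_nonneg fun i _ => Finset.sum_nonneg fun j _ =>
      Finset.sum_nonneg fun k _ => ω0 i j k)
  have hsq0 : 0 ≤ ∑ k, (δ k - θ * ω k) ^ 2 := Finset.sum_nonneg fun _ _ => sq_nonneg _
  have hz : ∑ k, ω k * (β + δ k) = 0 := by nlinarith
  refine ⟨θ, hθ0, hβθ, fun k => ?_, fun i j k h => ?_⟩
  · rw [hz, mul_zero] at hsum
    have := (Finset.sum_eq_zero_iff_of_nonneg fun _ _ => sq_nonneg _).1 hsum k (Finset.mem_univ _)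
    linarith [pow_eq_zero_iff two_ne_zero |>.1 this]
  -- Equality case: a vanishing sum of nonnegative terms, so every nonzero structure constant adds
  -- weights exactly.
  · have hz' : ∑ i, ∑ j, ∑ k, Q ⁅E i, E j⁆ (E k) ^ 2 * (ω k - ω i - ω j) = 0 := by linarith
    have z1 := (Finset.sum_eq_zero_iff_of_nonneg fun i _ => Finset.sum_nonneg fun j _ =>
      Finset.sum_nonneg fun k _ => ω0 i j k).1 hz' i (Finset.mem_univ _)
    have z2 := (Finset.sum_eq_zero_iff_of_nonneg fun j _ =>
      Finset.sum_nonneg fun k _ => ω0 i j k).1 z1 j (Finset.mem_univ _)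
    have z3 := (Finset.sum_eq_zero_iff_of_nonneg fun k _ => ω0 i j k).1 z2 k (Finset.mem_univ _)
    rcases mul_eq_zero.1 z3 with h' | h'
    · exact absurd (pow_eq_zero_iff two_ne_zero |>.1 h') h
    · linarith

end Graded

/-! ### The pre-Einstein weights of `Q_n` and their additive relations. -/

section Weights

/-- The coefficients of a bracket of the shape of `Q_n`, with arbitrary structure constants `c j` of
`[X_0, X_j]` and `d i` of `[X_i, X_{n-i}]`. -/
def filiformCoeff (n : ℕ) (c d : ℕ → ℝ) (i j k : ℕ) : ℝ :=
  if i = 0 ∧ 1 ≤ j ∧ j + 2 ≤ n then (if k = j + 1 then c j else 0)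
  else if j = 0 ∧ 1 ≤ i ∧ i + 2 ≤ n then (if k = i + 1 then -c i else 0)
  else if 1 ≤ i ∧ 1 ≤ j ∧ i + j = n then (if k = n then d i else 0)
  else 0

/-- `(i, j, k)` is a triple such that `X_k` occurs in `[X_i, X_j]` in `Q_n`. -/
def FiliformTriple (n i j k : ℕ) : Prop :=
  (i = 0 ∧ 1 ≤ j ∧ j + 2 ≤ n ∧ k = j + 1) ∨ (j = 0 ∧ 1 ≤ i ∧ i + 2 ≤ n ∧ k = i + 1) ∨
    (1 ≤ i ∧ 1 ≤ j ∧ i + j = n ∧ k = n)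

theorem FiliformTriple.of_filiformCoeff_ne_zero {n : ℕ} {c d : ℕ → ℝ} {i j k : ℕ}
    (h : filiformCoeff n c d i j k ≠ 0) : FiliformTriple n i j k := by
  unfold filiformCoeff at h
  unfold FiliformTriple
  split_ifs at h <;> first | omega | simp at h

/-- The additivity relations satisfied by the eigenvalues of a derivation of `Q_n`. -/
structure IsFiliformWeight (n : ℕ) (ψ : ℕ → ℝ) : Prop where
  succ : ∀ i, 1 ≤ i → i + 2 ≤ n → ψ (i + 1) = ψ 0 + ψ i
  last : ∀ i, 1 ≤ i → i + 1 ≤ n → ψ n = ψ i + ψ (n - i)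

theorem IsFiliformWeight.of_triple {n : ℕ} {ψ : ℕ → ℝ} (hψ : IsFiliformWeight n ψ) {i j k : ℕ}
    (h : FiliformTriple n i j k) : ψ k = ψ i + ψ j := by
  rcases h with ⟨rfl, h1, h2, rfl⟩ | ⟨rfl, h1, h2, rfl⟩ | ⟨h1, h2, h3, rfl⟩
  · exact hψ.succ j h1 h2
  · rw [hψ.succ i h1 h2, add_comm]
  · rw [hψ.last i h1 (by omega), show k - i = j by omega]

/-- Minus the Einstein constant of the model nilsoliton metric on `Q_n`. -/
noncomputable def filiformGamma (n : ℕ) : ℝ := n * (n - 1) * (n - 2) / 12 + 1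

/-- The weight of `X_1` under the pre-Einstein derivation of `Q_n`. -/
noncomputable def filiformTau (n : ℕ) : ℝ :=
  (2 - n) / 2 + filiformGamma n * (n + 1) / (n + 3)

/-- The eigenvalues of the pre-Einstein derivation of `Q_n`, normalized to `1` on `X_0`. -/
noncomputable def filiformWeight (n i : ℕ) : ℝ :=
  if i = 0 then 1 else if i < n then filiformTau n + i - 1 else 2 * filiformTau n + n - 2

theorem filiformWeight_zero (n : ℕ) : filiformWeight n 0 = 1 := by simp [filiformWeight]

theorem filiformWeight_of_lt {n i : ℕ} (h0 : 1 ≤ i) (h : i < n) :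
    filiformWeight n i = filiformTau n + i - 1 := by
  simp [filiformWeight, h, Nat.one_le_iff_ne_zero.1 h0]

theorem filiformWeight_self {n : ℕ} (h0 : 1 ≤ n) :
    filiformWeight n n = 2 * filiformTau n + n - 2 := by
  simp [filiformWeight, Nat.one_le_iff_ne_zero.1 h0]

theorem isFiliformWeight_filiformWeight (n : ℕ) :
    IsFiliformWeight n (filiformWeight n) where
  succ i h1 h2 := by
    rw [filiformWeight_zero, filiformWeight_of_lt (by omega) (by omega),
      filiformWeight_of_lt (by omega) (by omega)]
    push_cast
    ring
  last i h1 h2 := by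
    rw [filiformWeight_self (by omega), filiformWeight_of_lt (by omega) (by omega),
      filiformWeight_of_lt (by omega) (by omega), Nat.cast_sub (by omega)]
    ring

theorem filiformGamma_pos {n : ℕ} (hn3 : 3 ≤ n) : 0 < filiformGamma n := by
  have : (3 : ℝ) ≤ n := by exact_mod_cast hn3
  have h1 : (0 : ℝ) ≤ n - 1 := by linarith
  have h2 : (0 : ℝ) ≤ n - 2 := by linarith
  unfold filiformGamma
  positivity

theorem filiformTau_three : filiformTau 3 = 1 / 2 := by
  norm_num [filiformTau, filiformGamma]

theorem lt_filiformTau {n : ℕ} (hn : 5 ≤ n) : (n : ℝ) - 3 < filiformTau n := by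
  -- In terms of `m = n - 5` the difference is a quotient of polynomials with positive coefficients.
  obtain ⟨m, rfl⟩ := Nat.exists_eq_add_of_le hn
  unfold filiformTau filiformGamma
  push_cast
  rw [← sub_pos]
  have : (2 - (5 + (m : ℝ))) / 2 +
      ((5 + m) * (5 + m - 1) * (5 + m - 2) / 12 + 1) * (5 + m + 1) / (5 + m + 3) - (5 + m - 3) =
      ((m : ℝ) ^ 4 + 18 * m ^ 3 + 101 * m ^ 2 + 168 * m + 96) / (12 * (m + 8)) := by
    field_simp
    ring
  rw [this]
  positivity

theorem filiformTau_pos {n : ℕ} (hn : Odd n) (hn3 : 3 ≤ n) : 0 < filiformTau n := by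
  rcases eq_or_lt_of_le hn3 with rfl | h
  · rw [filiformTau_three]; norm_num
  · have h5 : 5 ≤ n := by obtain ⟨k, rfl⟩ := hn; omega
    have := lt_filiformTau h5
    have : (5 : ℝ) ≤ n := by exact_mod_cast h5
    linarith

theorem filiformWeight_pos {n : ℕ} (hn : Odd n) (hn3 : 3 ≤ n) (i : ℕ) :
    0 < filiformWeight n i := by
  have ht := filiformTau_pos hn hn3
  have h3 : (3 : ℝ) ≤ n := by exact_mod_cast hn3
  unfold filiformWeight
  split_ifs with h0 h1
  · norm_num
  · have : (1 : ℝ) ≤ i := by exact_mod_cast Nat.one_le_iff_ne_zero.2 h0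
    linarith
  · linarith

/-- The weight of `X_1` is `1 / 2` for `n = 3` and is large otherwise. -/
theorem filiformTau_cases {n : ℕ} (hn : Odd n) (hn3 : 3 ≤ n) :
    (n = 3 ∧ filiformTau n = 1 / 2) ∨ (5 ≤ n ∧ (n : ℝ) - 3 < filiformTau n) := by
  rcases eq_or_lt_of_le hn3 with rfl | h
  · exact Or.inl ⟨rfl, filiformTau_three⟩
  · have h5 : 5 ≤ n := by obtain ⟨k, rfl⟩ := hn; omega
    exact Or.inr ⟨h5, lt_filiformTau h5⟩

/-- Excludes accidental coincidences of weights, each of which would make `filiformTau n` an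
integer. The bound `n - 3` is the largest value of `k + 1 - i - j` with `k < n` and `3 ≤ i + j`. -/
theorem filiformTau_ne_cast {n : ℕ} (hn : Odd n) (hn3 : 3 ≤ n) {a : ℤ} (ha : a ≤ n - 3) :
    filiformTau n ≠ a := by
  intro h
  rcases filiformTau_cases hn hn3 with ⟨rfl, ht⟩ | ⟨h5, ht⟩
  · rw [ht] at h
    have h2 : ((1 : ℤ) : ℝ) = ((2 * a : ℤ) : ℝ) := by push_cast; linarith
    have := Int.cast_injective h2
    omega
  · rw [h] at ht
    have h2 : ((n - 3 : ℤ) : ℝ) < (a : ℝ) := by push_cast; exact ht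
    have := Int.cast_lt.1 h2
    omega

theorem filiformTau_ne_one {n : ℕ} (hn : Odd n) (hn3 : 3 ≤ n) : filiformTau n ≠ 1 := by
  rcases filiformTau_cases hn hn3 with ⟨rfl, ht⟩ | ⟨h5, ht⟩
  · rw [ht]; norm_num
  · have : (5 : ℝ) ≤ n := by exact_mod_cast h5
    linarith

/-- The weights of `X_1, …, X_n` increase strictly, so only the weight `1` of `X_0` could be
repeated; that is excluded by the arithmetic of `filiformTau n`. -/
theorem filiformWeight_injective {n : ℕ} (hn : Odd n) (hn3 : 3 ≤ n) {i j : ℕ} (hi : i ≤ n)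
    (hj : j ≤ n) (h : filiformWeight n i = filiformWeight n j) : i = j := by
  have ht := filiformTau_pos hn hn3
  have ht1 := filiformTau_ne_one hn hn3
  have h3 : (3 : ℝ) ≤ n := by exact_mod_cast hn3
  have key : ∀ i j : ℕ, i < j → j ≤ n → filiformWeight n i ≠ filiformWeight n j := by
    intro i j hij hj h
    have hij' : (i : ℝ) + 1 ≤ j := by exact_mod_cast hij
    rcases Nat.eq_zero_or_pos i with rfl | hi0
    · rw [filiformWeight_zero] at h
      rcases hj.lt_or_eq with hjn | rfl
      · rw [filiformWeight_of_lt hij hjn] at h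
        have h2 : filiformTau n = ((2 - j : ℤ) : ℝ) := by push_cast; linarith
        rcases eq_or_ne j 1 with rfl | hj1
        · exact ht1 (by rw [h2]; norm_num)
        · exact filiformTau_ne_cast hn hn3 (by omega) h2
      · rw [filiformWeight_self hij] at h
        linarith
    · rw [filiformWeight_of_lt hi0 (by omega)] at h
      rcases hj.lt_or_eq with hjn | rfl
      · rw [filiformWeight_of_lt (by omega) hjn] at h
        linarith
      · rw [filiformWeight_self (by omega)] at h
        linarith
  rcases lt_trichotomy i j with hij | hij | hij
  · exact absurd h (key i j hij hj)
  · exact hij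
  · exact absurd h.symm (key j i hij hi)

/-- The only additive relations between distinct weights are those coming from brackets. -/
theorem FiliformTriple.of_weight_eq {n : ℕ} (hn : Odd n) (hn3 : 3 ≤ n) {i j k : ℕ} (hi : i ≤ n)
    (hj : j ≤ n) (hk : k ≤ n) (hij : i ≠ j)
    (h : filiformWeight n k = filiformWeight n i + filiformWeight n j) :
    FiliformTriple n i j k := by
  have ht := filiformTau_pos hn hn3
  have ht1 := filiformTau_ne_one hn hn3
  have h3 : (3 : ℝ) ≤ n := by exact_mod_cast hn3
  have hwi := filiformWeight_pos hn hn3 i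
  have hwj := filiformWeight_pos hn hn3 j
  have hle : ∀ m ≤ n, filiformWeight n m ≤ filiformWeight n n := by
    intro m hm
    rw [filiformWeight_self (by omega)]
    rcases Nat.eq_zero_or_pos m with rfl | hm0
    · rw [filiformWeight_zero]; linarith
    · rcases hm.lt_or_eq with hmn | rfl
      · rw [filiformWeight_of_lt hm0 hmn]
        have : (m : ℝ) + 1 ≤ n := by exact_mod_cast hmn
        linarith
      · rw [filiformWeight_self hm0]
  have hin : i < n := by
    rcases hi.lt_or_eq with h' | rfl
    · exact h'
    · linarith [hle k hk]
  have hjn : j < n := by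
    rcases hj.lt_or_eq with h' | rfl
    · exact h'
    · linarith [hle k hk]
  have zero_case : ∀ j, 1 ≤ j → j < n →
      filiformWeight n k = filiformWeight n 0 + filiformWeight n j → j + 2 ≤ n ∧ k = j + 1 := by
    intro j hj hjn h
    have hj' : (1 : ℝ) ≤ j := by exact_mod_cast hj
    rw [filiformWeight_zero, filiformWeight_of_lt hj hjn] at h
    rcases Nat.eq_zero_or_pos k with rfl | hk0
    · rw [filiformWeight_zero] at h
      linarith
    · rcases hk.lt_or_eq with hkn | rfl
      · rw [filiformWeight_of_lt hk0 hkn] at h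
        have : k = j + 1 := by
          have : (k : ℝ) = (j + 1 : ℕ) := by push_cast; linarith
          exact_mod_cast this
        omega
      · rw [filiformWeight_self (by omega)] at h
        have h2 : filiformTau k = ((j + 2 - k : ℤ) : ℝ) := by push_cast; linarith
        rcases eq_or_ne (j + 1) k with hjk | hjk
        · exact absurd (by rw [h2, ← hjk]; push_cast; ring) ht1
        · have : (j + 2 : ℝ) ≤ k := by exact_mod_cast (by omega : j + 2 ≤ k)
          push_cast at h2
          linarith
  rcases Nat.eq_zero_or_pos i with rfl | hi0
  · exact Or.inl ⟨rfl, by omega, zero_case j (by omega) hjn h⟩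
  rcases Nat.eq_zero_or_pos j with rfl | hj0
  · exact Or.inr (Or.inl ⟨rfl, by omega, zero_case i (by omega) hin (by rw [h, add_comm])⟩)
  have hi' : (1 : ℝ) ≤ i := by exact_mod_cast hi0
  have hj' : (1 : ℝ) ≤ j := by exact_mod_cast hj0
  -- Here `i ≠ j` is essential: for `n = 3` twice the weight of `X_1` equals the weight of `X_0`.
  have hij' : (3 : ℝ) ≤ i + j := by exact_mod_cast (by omega : 3 ≤ i + j)
  rw [filiformWeight_of_lt hi0 hin, filiformWeight_of_lt hj0 hjn] at h
  refine Or.inr (Or.inr ⟨hi0, hj0, ?_⟩)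
  rcases Nat.eq_zero_or_pos k with rfl | hk0
  · rw [filiformWeight_zero] at h
    linarith
  · rcases hk.lt_or_eq with hkn | rfl
    · rw [filiformWeight_of_lt hk0 hkn] at h
      have h2 : filiformTau n = ((k + 1 - i - j : ℤ) : ℝ) := by push_cast; linarith
      exact absurd h2 (filiformTau_ne_cast hn hn3 (by omega))
    · rw [filiformWeight_self (by omega)] at h
      have : ((i + j : ℕ) : ℝ) = k := by push_cast; linarith
      exact ⟨by exact_mod_cast this, rfl⟩

/-- The pre-Einstein identity. -/
theorem IsFiliformWeight.sum_weight_mul {n : ℕ} (hn3 : 3 ≤ n) {ψ : ℕ → ℝ}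
    (hψ : IsFiliformWeight n ψ) :
    ∑ k : Fin (n + 1), filiformWeight n k * ψ k =
      filiformGamma n * ∑ k : Fin (n + 1), ψ k := by
  obtain ⟨N, rfl⟩ : ∃ N, n = N + 2 := ⟨n - 2, by omega⟩
  have h1 : ∀ i, i ≤ N → ψ (i + 1) = ψ 1 + i * ψ 0 := by
    intro i
    induction i with
    | zero => simp
    | succ i ih =>
      intro hi
      rw [hψ.succ (i + 1) (by omega) (by omega), ih (by omega)]
      push_cast
      ring
  have h2 : ψ (N + 2) = 2 * ψ 1 + N * ψ 0 := by
    rw [hψ.last 1 le_rfl (by omega), show N + 2 - 1 = N + 1 by omega, h1 N le_rfl]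
    ring
  have s1 : ∀ t x y : ℝ, ∀ M : ℕ, ∑ i ∈ Finset.range M, (t + i) * (x + i * y) =
      M * t * x + (t * y + x) * (M * (M - 1) / 2) + y * ((M - 1) * M * (2 * M - 1) / 6) := by
    intro t x y M
    induction M with
    | zero => simp
    | succ M ih =>
      rw [Finset.sum_range_succ, ih]
      push_cast
      ring
  have s0 : ∀ f : ℕ → ℝ, ∑ k ∈ Finset.range (N + 2 + 1), f k =
      ∑ k ∈ Finset.range (N + 1), f (k + 1) + f 0 + f (N + 2) := by
    intro f
    rw [Finset.sum_range_succ, Finset.sum_range_succ']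
  rw [Fin.sum_univ_eq_sum_range (fun k => filiformWeight (N + 2) k * ψ k),
    Fin.sum_univ_eq_sum_range ψ, s0, s0]
  have e1 : ∑ k ∈ Finset.range (N + 1), filiformWeight (N + 2) (k + 1) * ψ (k + 1) =
      ∑ i ∈ Finset.range (N + 1), (filiformTau (N + 2) + i) * (ψ 1 + i * ψ 0) := by
    refine Finset.sum_congr rfl fun k hk => ?_
    have hk := Finset.mem_range.1 hk
    rw [filiformWeight_of_lt (by omega) (by omega), h1 k (by omega)]
    push_cast
    ring
  -- Written as a difference so that `s1` applies with `t = 1` and `t = 0`.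
  have e2 : ∑ k ∈ Finset.range (N + 1), ψ (k + 1) =
      ∑ i ∈ Finset.range (N + 1), ((1 : ℝ) + i) * (ψ 1 + i * ψ 0)
        - ∑ i ∈ Finset.range (N + 1), ((0 : ℝ) + i) * (ψ 1 + i * ψ 0) := by
    rw [← Finset.sum_sub_distrib]
    refine Finset.sum_congr rfl fun k hk => ?_
    have hk := Finset.mem_range.1 hk
    rw [h1 k (by omega)]
    ring
  rw [e1, e2, s1, s1, s1, h2, filiformWeight_zero, filiformWeight_self (by omega)]
  -- Both sides are linear in `ψ 0` and `ψ 1`. Comparing coefficients gives two linear equations,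
  -- whose unique solution is the pair `filiformTau`, `filiformGamma`.
  unfold filiformTau filiformGamma
  push_cast
  field_simp
  ring

end Weights

/-! ### Brackets of basis vectors read off from `filiformCoeff`. -/

section FiliformBasis

variable {L : Type*} [LieRing L] [LieAlgebra ℝ L] {n : ℕ} {c d : ℕ → ℝ}
  {Y : Module.Basis (Fin (n + 1)) ℝ L}

theorem lie_basis_of_filiformCoeff
    (hY : ∀ i j k : Fin (n + 1), Y.repr ⁅Y i, Y j⁆ k = filiformCoeff n c d i j k)
    {i j k : Fin (n + 1)} (h : ∀ l : Fin (n + 1), l ≠ k → filiformCoeff n c d i j l = 0) :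
    ⁅Y i, Y j⁆ = filiformCoeff n c d i j k • Y k := by
  refine Y.ext_elem fun l => ?_
  rw [hY, map_smul, Module.Basis.repr_self, Finsupp.smul_apply, smul_eq_mul]
  rcases eq_or_ne l k with rfl | hl
  · simp
  · rw [h l hl, Finsupp.single_eq_of_ne hl, mul_zero]

theorem lie_zero_of_filiformCoeff
    (hY : ∀ i j k : Fin (n + 1), Y.repr ⁅Y i, Y j⁆ k = filiformCoeff n c d i j k)
    {i j k : Fin (n + 1)} (hi : (i : ℕ) = 0) (h1 : 1 ≤ (j : ℕ)) (h2 : (j : ℕ) + 2 ≤ n)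
    (hk : (k : ℕ) = j + 1) : ⁅Y i, Y j⁆ = c j • Y k := by
  rw [lie_basis_of_filiformCoeff hY (k := k)]
  · simp [filiformCoeff, hi, h1, h2, hk]
  · intro l hl
    have : (l : ℕ) ≠ j + 1 := fun h => hl (Fin.ext (by omega))
    simp [filiformCoeff, hi, h1, h2, this]

theorem lie_last_of_filiformCoeff
    (hY : ∀ i j k : Fin (n + 1), Y.repr ⁅Y i, Y j⁆ k = filiformCoeff n c d i j k)
    {i j k : Fin (n + 1)} (h1 : 1 ≤ (i : ℕ)) (h2 : 1 ≤ (j : ℕ)) (hij : (i : ℕ) + j = n)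
    (hk : (k : ℕ) = n) : ⁅Y i, Y j⁆ = d i • Y k := by
  have hi0 : (i : ℕ) ≠ 0 := by omega
  have hj0 : (j : ℕ) ≠ 0 := by omega
  rw [lie_basis_of_filiformCoeff hY (k := k)]
  · simp [filiformCoeff, hi0, hj0, h1, h2, hij, hk]
  · intro l hl
    have : (l : ℕ) ≠ n := fun h => hl (Fin.ext (by omega))
    simp [filiformCoeff, hi0, hj0, h1, h2, hij, this]

theorem lie_eq_zero_of_filiformCoeff
    (hY : ∀ i j k : Fin (n + 1), Y.repr ⁅Y i, Y j⁆ k = filiformCoeff n c d i j k)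
    {i j : Fin (n + 1)} (h : ∀ k : Fin (n + 1), ¬ FiliformTriple n i j k) : ⁅Y i, Y j⁆ = 0 := by
  refine Y.ext_elem fun k => ?_
  rw [hY, map_zero, Finsupp.zero_apply]
  by_contra hne
  exact h k (.of_filiformCoeff_ne_zero hne)

end FiliformBasis

/-! ### Derivations of `Q_n` and the weight filtration. -/

namespace FiliformQ

variable {n : ℕ} {hn : Odd n}

theorem X_repr_lie_eq_filiformCoeff (n : ℕ) (hn : Odd n) (i j k : Fin (n + 1)) :
    (X n hn).repr ⁅X n hn i, X n hn j⁆ k =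
      filiformCoeff n (fun _ => 1) (fun i => (-1) ^ i) i j k :=
  X_repr_lie i j k

theorem triple_of_repr_lie_ne_zero {i j k : Fin (n + 1)}
    (h : (X n hn).repr ⁅X n hn i, X n hn j⁆ k ≠ 0) : FiliformTriple n i j k := by
  rw [X_repr_lie_eq_filiformCoeff] at h
  exact .of_filiformCoeff_ne_zero h

theorem repr_lie_left (z : FiliformQ n hn) (i k : Fin (n + 1)) :
    (X n hn).repr ⁅X n hn i, z⁆ k =
      ∑ a, (X n hn).repr z a * (X n hn).repr ⁅X n hn i, X n hn a⁆ k := by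
  rw [repr_lie_eq_sum, Finset.sum_eq_single i]
  · simp
  · intro b _ hb
    simp [Finsupp.single_eq_of_ne hb]
  · simp

theorem repr_lie_left_eq_zero {z : FiliformQ n hn} {i k : Fin (n + 1)}
    (h : ∀ a : Fin (n + 1), FiliformTriple n i a k → (X n hn).repr z a = 0) :
    (X n hn).repr ⁅X n hn i, z⁆ k = 0 := by
  rw [repr_lie_left]
  refine Finset.sum_eq_zero fun a _ => ?_
  by_contra hne
  exact left_ne_zero_of_mul hne (h a (triple_of_repr_lie_ne_zero (right_ne_zero_of_mul hne)))

theorem repr_lie_left_eq {z : FiliformQ n hn} {i k : Fin (n + 1)} (a : Fin (n + 1))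
    (h : ∀ b : Fin (n + 1), FiliformTriple n i b k → b = a) :
    (X n hn).repr ⁅X n hn i, z⁆ k =
      (X n hn).repr z a * (X n hn).repr ⁅X n hn i, X n hn a⁆ k := by
  rw [repr_lie_left, Finset.sum_eq_single a]
  · intro b _ hb
    by_contra hne
    exact hb (h b (triple_of_repr_lie_ne_zero (right_ne_zero_of_mul hne)))
  · simp

/-- Derivations of `Q_n` map `X_k`, `k ≥ 2`, to the span of the `X_p` with `p ≥ k`. -/
theorem derivation_repr_eq_zero (hn3 : 3 ≤ n) (D : LieDerivation ℝ (FiliformQ n hn) (FiliformQ n hn))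
    {k p : Fin (n + 1)} (hk : 2 ≤ (k : ℕ)) (hp : (p : ℕ) < k) :
    (X n hn).repr (D (X n hn k)) p = 0 := by
  have hX := X_repr_lie_eq_filiformCoeff n hn
  -- Induction along `X_{m+1} = [X_0, X_m]`, starting from the fact that no bracket has an `X_0` or
  -- `X_1` component.
  have hlt : ∀ m : ℕ, 2 ≤ m → ∀ k p : Fin (n + 1), (k : ℕ) = m → m < n → (p : ℕ) < k →
      (X n hn).repr (D (X n hn k)) p = 0 := by
    intro m hm
    induction m, hm using Nat.le_induction with
    | base =>
      intro k p hk hkn hp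
      have := lie_zero_of_filiformCoeff hX (i := 0) (j := ⟨1, by omega⟩) (k := k) rfl le_rfl
        (by omega) hk
      rw [one_smul] at this
      rw [← this, LieDerivation.apply_lie_eq_sub, map_sub, Finsupp.sub_apply,
        repr_lie_left_eq_zero, repr_lie_left_eq_zero, sub_zero]
      · intro a ha
        simp [FiliformTriple] at ha
        omega
      · intro a ha
        simp [FiliformTriple] at ha
        omega
    | succ m hm ih =>
      intro k p hk hkn hp
      have := lie_zero_of_filiformCoeff hX (i := 0) (j := ⟨m, by omega⟩) (k := k) rfl
        (show 1 ≤ m by omega) (show m + 2 ≤ n by omega) hk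
      rw [one_smul] at this
      rw [← this, LieDerivation.apply_lie_eq_sub, map_sub, Finsupp.sub_apply,
        repr_lie_left_eq_zero, repr_lie_left_eq_zero, sub_zero]
      · intro a ha
        simp [FiliformTriple] at ha
        omega
      · intro a ha
        simp [FiliformTriple] at ha
        exact ih _ _ rfl (by omega) (show (a : ℕ) < m by omega)
  rcases lt_or_ge (k : ℕ) n with hkn | hkn
  · exact hlt k hk k p rfl hkn hp
  · have hkn : (k : ℕ) = n := by omega
    have := lie_last_of_filiformCoeff hX (i := ⟨1, by omega⟩) (j := ⟨n - 1, by omega⟩) (k := k)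
      le_rfl (show 1 ≤ n - 1 by omega) (show 1 + (n - 1) = n by omega) hkn
    rw [show X n hn k = -⁅X n hn ⟨1, by omega⟩, X n hn ⟨n - 1, by omega⟩⁆ by rw [this]; simp,
      map_neg, map_neg, Finsupp.neg_apply, neg_eq_zero,
      LieDerivation.apply_lie_eq_sub, map_sub, Finsupp.sub_apply,
      repr_lie_left_eq_zero, repr_lie_left_eq_zero, sub_zero]
    · intro a ha
      simp [FiliformTriple] at ha
      omega
    · intro a ha
      unfold FiliformTriple at ha
      dsimp only at ha
      exact hlt (n - 1) (by omega) _ _ rfl (by omega) (show (a : ℕ) < n - 1 by omega)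

/-- Derivations of `Q_n` preserve the filtration by weights. -/
theorem derivation_repr_eq_zero_of_weight_lt (hn3 : 3 ≤ n)
    (D : LieDerivation ℝ (FiliformQ n hn) (FiliformQ n hn)) {k p : Fin (n + 1)}
    (h : filiformWeight n p < filiformWeight n k) : (X n hn).repr (D (X n hn k)) p = 0 := by
  have hX := X_repr_lie_eq_filiformCoeff n hn
  have ht := filiformTau_pos hn hn3
  have hmono : ∀ i j : ℕ, 1 ≤ i → i < j → j ≤ n → filiformWeight n i < filiformWeight n j := by
    intro i j hi hij hj
    have hij' : (i : ℝ) + 1 ≤ j := by exact_mod_cast hij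
    have hj' : (j : ℝ) ≤ n := by exact_mod_cast hj
    rw [filiformWeight_of_lt hi (by omega)]
    rcases hj.lt_or_eq with hjn | rfl
    · rw [filiformWeight_of_lt (by omega) hjn]
      linarith
    · rw [filiformWeight_self (by omega)]
      linarith
  have hp1 : 1 ≤ (k : ℕ) → 1 ≤ (p : ℕ) → (p : ℕ) < k := by
    intro hk hp
    by_contra hle
    rcases (not_lt.1 hle).lt_or_eq with h' | h'
    · exact lt_asymm h (hmono k p hk h' (by omega))
    · rw [h'] at h
      exact lt_irrefl _ h
  rcases lt_or_ge (k : ℕ) 2 with hk | hk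
  · obtain hk | hk : (k : ℕ) = 0 ∨ (k : ℕ) = 1 := by omega
    · obtain rfl : k = 0 := Fin.ext hk
      have hp : (p : ℕ) = 1 := by
        by_contra hp
        rcases Nat.eq_zero_or_pos (p : ℕ) with hp0 | hp0
        · rw [hp0] at h
          exact lt_irrefl _ h
        · have h1 := hmono 1 p le_rfl (by omega) (by omega)
          rw [Fin.val_zero, filiformWeight_zero] at h
          rcases (show (p : ℕ) ≤ n by omega).lt_or_eq with hpn | hpn
          · rw [filiformWeight_of_lt hp0 hpn] at h
            have : (2 : ℝ) ≤ (p : ℕ) := by exact_mod_cast (by omega : 2 ≤ (p : ℕ))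
            linarith
          · rw [hpn, filiformWeight_self (by omega)] at h
            have : (3 : ℝ) ≤ n := by exact_mod_cast hn3
            linarith
      rw [hp, Fin.val_zero, filiformWeight_zero, filiformWeight_of_lt le_rfl (by omega)] at h
      -- Only for `n = 3` is `X_1` lighter than `X_0`. The `X_1` component of `D X_0` is then read
      -- off from the `X_3` component of `D [X_0, X_2] = 0`.
      rcases filiformTau_cases hn hn3 with ⟨h3, -⟩ | ⟨h5, ht5⟩
      · have e0 : ⁅X n hn 0, X n hn ⟨2, by omega⟩⁆ = 0 :=
          lie_eq_zero_of_filiformCoeff hX (by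
            intro k
            simp [FiliformTriple]
            omega)
        have e1 := congrArg (fun z => (X n hn).repr (D z) ⟨3, by omega⟩) e0
        simp only [map_zero, Finsupp.zero_apply, LieDerivation.apply_lie_eq_sub, map_sub,
          Finsupp.sub_apply] at e1
        rw [repr_lie_left_eq_zero, repr_lie_left_eq p, hX] at e1
        · simpa [filiformCoeff, hp, h3] using e1
        · intro b hb
          simp [FiliformTriple] at hb
          exact Fin.ext (by omega)
        · intro a ha
          simp [FiliformTriple] at ha
          omega
      · push_cast at h
        have : (5 : ℝ) ≤ n := by exact_mod_cast h5
        linarith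
    · have hp : (p : ℕ) = 0 := by
        by_contra hp
        have := hp1 (by omega) (by omega)
        omega
      obtain rfl : p = 0 := Fin.ext hp
      rw [hk, Fin.val_zero, filiformWeight_zero, filiformWeight_of_lt le_rfl (by omega)] at h
      rcases filiformTau_cases hn hn3 with ⟨-, ht3⟩ | ⟨h5, -⟩
      · rw [ht3] at h
        norm_num at h
      -- For `n ≥ 5` the vectors `X_2` and `X_1` commute, and the `X_3` component of `D [X_2, X_1] =
      -- 0` isolates the `X_0` component of `D X_1`.
      · have e0 : ⁅X n hn ⟨2, by omega⟩, X n hn k⁆ = 0 :=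
          lie_eq_zero_of_filiformCoeff hX (by
            intro k
            simp [FiliformTriple]
            omega)
        have e1 := congrArg (fun z => (X n hn).repr (D z) ⟨3, by omega⟩) e0
        simp only [map_zero, Finsupp.zero_apply, LieDerivation.apply_lie_eq_sub, map_sub,
          Finsupp.sub_apply] at e1
        rw [repr_lie_left_eq 0, repr_lie_left_eq_zero (i := k), hX] at e1
        · simpa [filiformCoeff, show 4 ≤ n by omega] using e1
        · intro a ha
          simp [FiliformTriple] at ha
          omega
        · intro b hb
          simp [FiliformTriple] at hb
          exact Fin.ext (by simp; omega)
  · refine derivation_repr_eq_zero hn3 D hk ?_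
    rcases Nat.eq_zero_or_pos (p : ℕ) with hp0 | hp0
    · omega
    · exact hp1 (by omega) hp0

end FiliformQ

/-! ### Ricci eigenvalues in terms of the constants `c` and `d`. -/

section FiliformRicci

theorem sum_filiformCoeff_sq (n : ℕ) (c d f : ℕ → ℝ) (i j : ℕ) :
    ∑ k : Fin (n + 1), filiformCoeff n c d i j k ^ 2 * f k =
      (if i = 0 ∧ 1 ≤ j ∧ j + 2 ≤ n then c j ^ 2 * f (j + 1) else 0) +
      (if j = 0 ∧ 1 ≤ i ∧ i + 2 ≤ n then c i ^ 2 * f (i + 1) else 0) +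
      (if 1 ≤ i ∧ 1 ≤ j ∧ i + j = n then d i ^ 2 * f n else 0) := by
  rw [Fin.sum_univ_eq_sum_range (fun k => filiformCoeff n c d i j k ^ 2 * f k) (n + 1)]
  unfold filiformCoeff
  by_cases h1 : i = 0 ∧ 1 ≤ j ∧ j + 2 ≤ n
  · rw [if_pos h1, if_neg (by omega), if_neg (by omega), Finset.sum_eq_single (j + 1)] <;>
      simp +contextual [h1]
    omega
  by_cases h2 : j = 0 ∧ 1 ≤ i ∧ i + 2 ≤ n
  · rw [if_neg h1, if_pos h2, if_neg (by omega), Finset.sum_eq_single (i + 1)] <;>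
      simp +contextual [h2]
    omega
  by_cases h3 : 1 ≤ i ∧ 1 ≤ j ∧ i + j = n
  · have hi : i ≠ 0 := by omega
    have hj : j ≠ 0 := by omega
    rw [if_neg h1, if_neg h2, if_pos h3, Finset.sum_eq_single n] <;>
      simp +contextual [hi, hj, h3]
  · simp [h1, h2, h3]

/-- The squares of the constants `c`, extended by zero. -/
def filiformA (n : ℕ) (c : ℕ → ℝ) (j : ℕ) : ℝ := if 1 ≤ j ∧ j + 2 ≤ n then c j ^ 2 else 0

/-- The squares of the constants `d`, extended by zero. -/
def filiformB (n : ℕ) (d : ℕ → ℝ) (i : ℕ) : ℝ := if 1 ≤ i ∧ i + 1 ≤ n then d i ^ 2 else 0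

variable {L : Type*} [LieRing L] [LieAlgebra ℝ L] {n : ℕ} {c d : ℕ → ℝ}
  {Q : LinearMap.BilinForm ℝ L} {E : Module.Basis (Fin (n + 1)) ℝ L}

/-- Testing with indicator functions `ψ` extracts single Ricci eigenvalues. Each `[E_0, E_j]` occurs
in both orders, whence `1/2`; the sum over `i` already contains both orders of `[E_i, E_{n-i}]`, so
its factor stays `1/4`. -/
theorem sum_mul_nilRicciForm_filiform (hE : IsOrthonormalBasis Q E)
    (hw : ∀ i j k : Fin (n + 1), Q ⁅E i, E j⁆ (E k) = filiformCoeff n c d i j k) (ψ : ℕ → ℝ) :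
    ∑ p : Fin (n + 1), ψ p * nilRicciForm Q E (E p) (E p) =
      (1 / 2) * ∑ j ∈ Finset.range (n + 1), filiformA n c j * (ψ (j + 1) - ψ 0 - ψ j) +
      (1 / 4) * ∑ i ∈ Finset.range (n + 1), filiformB n d i * (ψ n - ψ i - ψ (n - i)) := by
  rw [sum_mul_nilRicciForm hE (fun p => ψ p)]
  simp only [hw, fun i j : ℕ => sum_filiformCoeff_sq n c d (fun k => ψ k - ψ i - ψ j) i j,
    Finset.sum_add_distrib]
  have e1 : ∑ i : Fin (n + 1), ∑ j : Fin (n + 1),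
      (if (i : ℕ) = 0 ∧ 1 ≤ (j : ℕ) ∧ (j : ℕ) + 2 ≤ n then
        c j ^ 2 * (ψ (j + 1) - ψ i - ψ j) else 0) =
      ∑ j ∈ Finset.range (n + 1), filiformA n c j * (ψ (j + 1) - ψ 0 - ψ j) := by
    rw [Finset.sum_eq_single 0]
    · rw [← Fin.sum_univ_eq_sum_range]
      refine Finset.sum_congr rfl fun j _ => ?_
      simp [filiformA]
    · intro i _ hi
      refine Finset.sum_eq_zero fun j _ => if_neg fun h => hi (Fin.ext h.1)
    · simp
  have e2 : ∑ i : Fin (n + 1), ∑ j : Fin (n + 1),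
      (if (j : ℕ) = 0 ∧ 1 ≤ (i : ℕ) ∧ (i : ℕ) + 2 ≤ n then
        c i ^ 2 * (ψ (i + 1) - ψ i - ψ j) else 0) =
      ∑ j ∈ Finset.range (n + 1), filiformA n c j * (ψ (j + 1) - ψ 0 - ψ j) := by
    rw [← e1, Finset.sum_comm]
    refine Finset.sum_congr rfl fun j _ => Finset.sum_congr rfl fun i _ => ?_
    rw [sub_right_comm]
  have e3 : ∑ i : Fin (n + 1), ∑ j : Fin (n + 1),
      (if 1 ≤ (i : ℕ) ∧ 1 ≤ (j : ℕ) ∧ (i : ℕ) + j = n then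
        d i ^ 2 * (ψ n - ψ i - ψ j) else 0) =
      ∑ i ∈ Finset.range (n + 1), filiformB n d i * (ψ n - ψ i - ψ (n - i)) := by
    rw [← Fin.sum_univ_eq_sum_range]
    refine Finset.sum_congr rfl fun i _ => ?_
    rw [Finset.sum_eq_single ⟨n - i, by omega⟩]
    · unfold filiformB
      by_cases h : 1 ≤ (i : ℕ) ∧ (i : ℕ) + 1 ≤ n
      · rw [if_pos h, if_pos]
        dsimp only
        omega
      · rw [if_neg h, if_neg, zero_mul]
        dsimp only
        omega
    · intro j _ hj
      exact if_neg fun h => hj (Fin.ext (by dsimp only; omega))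
    · simp
  rw [e1, e2, e3]
  ring

theorem nilRicciForm_filiform_mid (hE : IsOrthonormalBasis Q E)
    (hw : ∀ i j k : Fin (n + 1), Q ⁅E i, E j⁆ (E k) = filiformCoeff n c d i j k)
    {p : Fin (n + 1)} (h1 : 1 ≤ (p : ℕ)) (h2 : (p : ℕ) + 1 ≤ n) :
    nilRicciForm Q E (E p) (E p) =
      (1 / 2) * (filiformA n c (p - 1) - filiformA n c p) -
      (1 / 4) * (filiformB n d p + filiformB n d (n - p)) := by
  have h := sum_mul_nilRicciForm_filiform hE hw (fun q => if q = (p : ℕ) then 1 else 0)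
  rw [Finset.sum_eq_single p (fun q _ hq => by
    rw [if_neg fun h => hq (Fin.ext h), zero_mul]) (by simp), if_pos rfl, one_mul] at h
  rw [h]
  have e1 : ∑ j ∈ Finset.range (n + 1), filiformA n c j *
      ((if j + 1 = (p : ℕ) then (1 : ℝ) else 0) - (if 0 = (p : ℕ) then 1 else 0) -
        (if j = (p : ℕ) then 1 else 0)) = filiformA n c (p - 1) - filiformA n c p := by
    simp only [if_neg (show 0 ≠ (p : ℕ) by omega), sub_zero, mul_sub, mul_ite, mul_one, mul_zero,
      Finset.sum_sub_distrib]
    rw [Finset.sum_eq_single ((p : ℕ) - 1), Finset.sum_eq_single (p : ℕ), if_pos rfl,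
      if_pos (by omega)]
    · exact fun j _ hj => if_neg hj
    · exact fun h => absurd (Finset.mem_range.2 (by omega)) h
    · exact fun j _ hj => if_neg (by omega)
    · exact fun h => absurd (Finset.mem_range.2 (by omega)) h
  have e2 : ∑ i ∈ Finset.range (n + 1), filiformB n d i *
      ((if n = (p : ℕ) then (1 : ℝ) else 0) - (if i = (p : ℕ) then 1 else 0) -
        (if n - i = (p : ℕ) then 1 else 0)) = -(filiformB n d p + filiformB n d (n - p)) := by
    simp only [if_neg (show n ≠ (p : ℕ) by omega), zero_sub, mul_sub, mul_neg, mul_ite, mul_one,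
      mul_zero, Finset.sum_sub_distrib, Finset.sum_neg_distrib]
    rw [Finset.sum_eq_single (p : ℕ), Finset.sum_eq_single (n - (p : ℕ)), if_pos rfl,
      if_pos (by omega)]
    · ring
    · intro j hj hj'
      rw [Finset.mem_range] at hj
      exact if_neg (by omega)
    · exact fun h => absurd (Finset.mem_range.2 (by omega)) h
    · exact fun j _ hj => if_neg hj
    · exact fun h => absurd (Finset.mem_range.2 (by omega)) h
  rw [e1, e2]
  ring

theorem nilRicciForm_filiform_last (hn : 1 ≤ n) (hE : IsOrthonormalBasis Q E)
    (hw : ∀ i j k : Fin (n + 1), Q ⁅E i, E j⁆ (E k) = filiformCoeff n c d i j k) :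
    nilRicciForm Q E (E (Fin.last n)) (E (Fin.last n)) =
      (1 / 4) * ∑ i ∈ Finset.range (n + 1), filiformB n d i := by
  have h := sum_mul_nilRicciForm_filiform hE hw (fun q => if q = n then 1 else 0)
  rw [Finset.sum_eq_single (Fin.last n) (fun q _ hq => by
    rw [if_neg fun h : (q : ℕ) = n => hq (Fin.ext h), zero_mul]) (by simp), Fin.val_last] at h
  simp only [if_true, one_mul] at h
  rw [h]
  have e1 : ∑ j ∈ Finset.range (n + 1), filiformA n c j *
      ((if j + 1 = n then (1 : ℝ) else 0) - (if 0 = n then 1 else 0) -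
        (if j = n then 1 else 0)) = 0 := by
    refine Finset.sum_eq_zero fun j _ => ?_
    unfold filiformA
    split_ifs <;> first | omega | simp
  have e2 : ∑ i ∈ Finset.range (n + 1), filiformB n d i *
      ((1 : ℝ) - (if i = n then 1 else 0) -
        (if n - i = n then 1 else 0)) = ∑ i ∈ Finset.range (n + 1), filiformB n d i := by
    refine Finset.sum_congr rfl fun i hi => ?_
    unfold filiformB
    split_ifs <;> first | omega | simp
  rw [e1, e2]
  ring

end FiliformRicci

/-! ### The diagonal soliton equations as a recurrence. -/

section Sequences

/-- A maximum principle: the constants `b` in the diagonal soliton equations are all equal. -/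
theorem filiform_const_of_recurrence {n : ℕ} {a b : ℕ → ℝ} {u v : ℝ} (hn3 : 3 ≤ n)
    (ha0 : a 0 = 0) (han : a (n - 1) = 0) (ha : ∀ i, 1 ≤ i → i + 2 ≤ n → 0 < a i)
    (hb : ∀ i, 1 ≤ i → i + 1 ≤ n → 0 < b i) (hbs : ∀ i, 1 ≤ i → i + 1 ≤ n → b (n - i) = b i)
    (hab : ∀ i, 1 ≤ i → i + 2 ≤ n → a i * b (i + 1) = a (n - 1 - i) * b i)
    (h : ∀ k, 1 ≤ k → k + 1 ≤ n → a (k - 1) - a k - b k = u * k + v) :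
    ∀ k, 1 ≤ k → k + 1 ≤ n → b k = b 1 := by
  -- The defect of symmetry of `a`. Adding the equations at `k` and `n - k` gives `hrec`, a
  -- first-order recurrence for `e` with both end values zero.
  set e : ℕ → ℝ := fun i => a i - a (n - 1 - i) with he
  set C : ℝ := -(u * n + 2 * v) with hC
  have he0 : e 0 = 0 := by simp [he, ha0, han]
  have hen : e (n - 1) = 0 := by simp [he, ha0, han]
  have hrec : ∀ k, 1 ≤ k → k + 1 ≤ n → e k = e (k - 1) + (C - 2 * b k) := by
    intro k h1 h2
    have e1 := h k h1 h2
    have e2 := h (n - k) (by omega) (by omega)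
    rw [hbs k h1 h2, Nat.cast_sub (by omega)] at e2
    simp only [he, hC]
    rw [show n - 1 - (k - 1) = n - k by omega, show n - 1 - k = n - k - 1 by omega]
    linarith
  have hcmp : ∀ k, 1 ≤ k → k + 2 ≤ n → a k * (b (k + 1) - b k) = -(e k * b k) := by
    intro k h1 h2
    have := hab k h1 h2
    simp only [he]
    linarith
  -- If the first increment of `e` is positive then `e 1 > 0`, so `b` decreases by `hcmp`, so the
  -- next increment is positive too; `e` never returns to `0`. The case `hneg` is the mirror image.
  have hpos : ¬ 0 < C - 2 * b 1 := by
    intro h0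
    have : ∀ k, 1 ≤ k → k + 1 ≤ n → 0 < e k ∧ 0 < C - 2 * b k := by
      intro k hk
      induction k, hk using Nat.le_induction with
      | base =>
        intro h2
        refine ⟨?_, h0⟩
        rw [hrec 1 le_rfl h2, show 1 - 1 = 0 from rfl, he0]
        linarith
      | succ k hk ih =>
        intro h2
        obtain ⟨i1, i2⟩ := ih (by omega)
        have h3 := hcmp k hk (by omega)
        have h4 : b (k + 1) < b k := by
          have := mul_pos i1 (hb k hk (by omega))
          have := ha k hk (by omega)
          by_contra hcon
          have := mul_nonneg this.le (sub_nonneg.2 (not_lt.1 hcon))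
          linarith
        refine ⟨?_, by linarith⟩
        rw [hrec (k + 1) (by omega) h2, Nat.add_sub_cancel]
        linarith
    have := (this (n - 1) (by omega) (by omega)).1
    linarith
  have hneg : ¬ C - 2 * b 1 < 0 := by
    intro h0
    have : ∀ k, 1 ≤ k → k + 1 ≤ n → e k < 0 ∧ C - 2 * b k < 0 := by
      intro k hk
      induction k, hk using Nat.le_induction with
      | base =>
        intro h2
        refine ⟨?_, h0⟩
        rw [hrec 1 le_rfl h2, show 1 - 1 = 0 from rfl, he0]
        linarith
      | succ k hk ih =>
        intro h2
        obtain ⟨i1, i2⟩ := ih (by omega)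
        have h3 := hcmp k hk (by omega)
        have h4 : b k < b (k + 1) := by
          have := mul_neg_of_neg_of_pos i1 (hb k hk (by omega))
          have := ha k hk (by omega)
          by_contra hcon
          have := mul_nonneg this.le (sub_nonneg.2 (not_lt.1 hcon))
          linarith
        refine ⟨?_, by linarith⟩
        rw [hrec (k + 1) (by omega) h2, Nat.add_sub_cancel]
        linarith
    have := (this (n - 1) (by omega) (by omega)).1
    linarith
  have hz : C - 2 * b 1 = 0 := le_antisymm (not_lt.1 hpos) (not_lt.1 hneg)
  have : ∀ k, 1 ≤ k → k + 1 ≤ n → e k = 0 ∧ b k = b 1 := by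
    intro k hk
    induction k, hk using Nat.le_induction with
    | base =>
      intro h2
      refine ⟨?_, rfl⟩
      rw [hrec 1 le_rfl h2, show 1 - 1 = 0 from rfl, he0, hz, add_zero]
    | succ k hk ih =>
      intro h2
      obtain ⟨i1, i2⟩ := ih (by omega)
      have h3 := hcmp k hk (by omega)
      rw [i1, zero_mul, neg_zero] at h3
      have h4 : b (k + 1) = b 1 := by
        rcases mul_eq_zero.1 h3 with h' | h'
        · exact absurd h' (ha k hk (by omega)).ne'
        · linarith
      refine ⟨?_, h4⟩
      rw [hrec (k + 1) (by omega) h2, Nat.add_sub_cancel, h4, i1, hz, add_zero]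
  exact fun k h1 h2 => (this k h1 h2).2

/-- The common value of the squared constants `d` for the model nilsoliton metric. -/
noncomputable def filiformBeta (n : ℕ) : ℝ := 4 * filiformGamma n / (n + 3)

theorem filiformBeta_pos {n : ℕ} (hn3 : 3 ≤ n) : 0 < filiformBeta n :=
  div_pos (mul_pos (by norm_num) (filiformGamma_pos hn3)) (by positivity)

/-- This identity makes `a k = k (n - 1 - k)`, `b k = filiformBeta n` a solution of the recurrence
`a (k - 1) - a k - b k = 2 (ω k - γ)`. -/
theorem two_mul_filiformTau_sub (n : ℕ) :
    2 * (filiformTau n - filiformGamma n) = 2 - n - filiformBeta n := by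
  unfold filiformTau filiformBeta
  field_simp
  ring

/-- The diagonal soliton equations determine the structure constants up to sign and scaling. -/
theorem filiform_eq_of_recurrence {n : ℕ} {a b : ℕ → ℝ} {θ : ℝ} (hn3 : 3 ≤ n)
    (ha0 : a 0 = 0) (han : a (n - 1) = 0) (ha : ∀ i, 1 ≤ i → i + 2 ≤ n → 0 < a i)
    (hb : ∀ i, 1 ≤ i → i + 1 ≤ n → 0 < b i) (hbs : ∀ i, 1 ≤ i → i + 1 ≤ n → b (n - i) = b i)
    (hab : ∀ i, 1 ≤ i → i + 2 ≤ n → a i * b (i + 1) = a (n - 1 - i) * b i)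
    (h : ∀ k, 1 ≤ k → k + 1 ≤ n →
      a (k - 1) - a k - b k = 2 * θ * (filiformWeight n k - filiformGamma n)) :
    (∀ k, 1 ≤ k → k + 1 ≤ n → b k = θ * filiformBeta n) ∧
      ∀ k, 1 ≤ k → k + 2 ≤ n → a k = θ * (k * (n - 1 - k)) := by
  have h' : ∀ k, 1 ≤ k → k + 1 ≤ n →
      a (k - 1) - a k - b k = (2 * θ) * k + θ * (-n - filiformBeta n) := by
    intro k h1 h2
    rw [h k h1 h2, filiformWeight_of_lt h1 (by omega)]
    linear_combination θ * two_mul_filiformTau_sub n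
  have hconst := filiform_const_of_recurrence hn3 ha0 han ha hb hbs hab h'
  have hak : ∀ k, k + 1 ≤ n →
      a k = θ * (k * (n - 1 - k)) + k * (θ * filiformBeta n - b 1) := by
    intro k
    induction k with
    | zero => simp [ha0]
    | succ k ih =>
      intro hk
      have h1 := h' (k + 1) (by omega) hk
      rw [hconst (k + 1) (by omega) hk, Nat.add_sub_cancel, ih (by omega)] at h1
      push_cast at h1 ⊢
      linarith
  -- The boundary condition `a (n - 1) = 0` fixes the remaining constant `b 1`.
  have hb1 : θ * filiformBeta n - b 1 = 0 := by
    have h1 := hak (n - 1) (by omega)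
    rw [han, Nat.cast_sub (by omega), Nat.cast_one, sub_self, mul_zero, mul_zero, zero_add] at h1
    rcases mul_eq_zero.1 h1.symm with h2 | h2
    · have : (3 : ℝ) ≤ n := by exact_mod_cast hn3
      linarith
    · exact h2
  refine ⟨fun k h1 h2 => ?_, fun k h1 h2 => ?_⟩
  · rw [hconst k h1 h2]
    linarith
  · rw [hak k (by omega), hb1, mul_zero, add_zero]

end Sequences

/-! ### Rescaling an adapted basis to the standard brackets. -/

section Rescaling

/-- The squared lengths of `X_0, …, X_n` for the model nilsoliton metric. -/
noncomputable def filiformNorm (n i : ℕ) : ℝ :=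
  (if i < n then 1 else filiformBeta n) *
    ∏ j ∈ Finset.range (min i (n - 1) - 1), (((j + 1 : ℕ) : ℝ) * (n - 1 - (j + 1 : ℕ)))

theorem filiformNorm_zero {n : ℕ} (hn : 1 ≤ n) : filiformNorm n 0 = 1 := by
  simp [filiformNorm, show 0 < n by omega]

theorem filiformNorm_one {n : ℕ} (hn : 2 ≤ n) : filiformNorm n 1 = 1 := by
  simp [filiformNorm, show 1 < n by omega, show min 1 (n - 1) - 1 = 0 by omega]

theorem filiformNorm_succ {n i : ℕ} (h1 : 1 ≤ i) (h2 : i + 2 ≤ n) :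
    filiformNorm n (i + 1) = i * (n - 1 - i) * filiformNorm n i := by
  obtain ⟨m, rfl⟩ := Nat.exists_eq_add_of_le' h1
  unfold filiformNorm
  rw [if_pos (by omega), if_pos (by omega), show min (m + 1 + 1) (n - 1) - 1 = m + 1 by omega,
    show min (m + 1) (n - 1) - 1 = m by omega, Finset.prod_range_succ]
  ring

theorem filiformNorm_self {n : ℕ} (hn : 1 ≤ n) :
    filiformNorm n n = filiformBeta n * filiformNorm n (n - 1) := by
  unfold filiformNorm
  rw [if_neg (by omega), if_pos (by omega), show min n (n - 1) = n - 1 by omega, min_self, one_mul]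

theorem filiformNorm_pos {n : ℕ} (hn3 : 3 ≤ n) (i : ℕ) : 0 < filiformNorm n i := by
  refine mul_pos ?_ (Finset.prod_pos fun j hj => ?_)
  · split_ifs
    · exact one_pos
    · exact filiformBeta_pos hn3
  · have hj := Finset.mem_range.1 hj
    have h : ((j + 1 : ℕ) : ℝ) + 2 ≤ n := by exact_mod_cast (by omega : j + 1 + 2 ≤ n)
    exact mul_pos (by positivity) (by linarith)

/-- Rescaling factors turning the structure constants `c`, `d` into those of `Q_n`. -/
noncomputable def filiformScale (n : ℕ) (s : ℝ) (c d : ℕ → ℝ) (i : ℕ) : ℝ :=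
  if i = 0 then s
  else (if i < n then 1 else -(s * d 1)) *
    (s * ∏ j ∈ Finset.range (min i (n - 1) - 1), (s * c (j + 1)))

variable {n : ℕ} {s : ℝ} {c d : ℕ → ℝ}

theorem filiformScale_zero : filiformScale n s c d 0 = s := if_pos rfl

theorem filiformScale_one (hn : 2 ≤ n) : filiformScale n s c d 1 = s := by
  simp [filiformScale, show 1 < n by omega, show min 1 (n - 1) - 1 = 0 by omega]

theorem filiformScale_succ {i : ℕ} (h1 : 1 ≤ i) (h2 : i + 2 ≤ n) :
    filiformScale n s c d (i + 1) = s * c i * filiformScale n s c d i := by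
  obtain ⟨m, rfl⟩ := Nat.exists_eq_add_of_le' h1
  unfold filiformScale
  rw [if_neg (Nat.succ_ne_zero _), if_neg (Nat.succ_ne_zero _), if_pos (by omega),
    if_pos (by omega), show min (m + 1 + 1) (n - 1) - 1 = m + 1 by omega,
    show min (m + 1) (n - 1) - 1 = m by omega, Finset.prod_range_succ]
  ring

theorem filiformScale_self (hn : 2 ≤ n) :
    filiformScale n s c d n = -(s * d 1) * filiformScale n s c d (n - 1) := by
  unfold filiformScale
  rw [if_neg (by omega), if_neg (by omega), if_neg (by omega), if_pos (by omega),
    show min n (n - 1) = n - 1 by omega, min_self, one_mul]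

theorem filiformScale_ne_zero (hn : 2 ≤ n) (hs : s ≠ 0) (hc : ∀ i, 1 ≤ i → i + 2 ≤ n → c i ≠ 0)
    (hd : d 1 ≠ 0) (i : ℕ) : filiformScale n s c d i ≠ 0 := by
  unfold filiformScale
  split_ifs with h0
  · exact hs
  all_goals
    refine mul_ne_zero ?_ (mul_ne_zero hs (Finset.prod_ne_zero_iff.2 fun j hj => ?_))
    · simp [hs, hd]
    · have hj := Finset.mem_range.1 hj
      exact mul_ne_zero hs (hc _ (by omega) (by omega))

/-- The scales are defined so that `[Y_0, Y_j] = Y_{j+1}` and `[Y_1, Y_{n-1}] = -Y_n` for the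
rescaled vectors `Y_i`. The other brackets into `Y_n` follow by induction from the Jacobi relation
`hJ`. -/
theorem filiformScale_mul_filiformCoeff (hn : 2 ≤ n)
    (hJ : ∀ i, 1 ≤ i → i + 2 ≤ n → c i * d (i + 1) = -(c (n - 1 - i) * d i)) (i j k : ℕ) :
    filiformScale n s c d i * filiformScale n s c d j * filiformCoeff n c d i j k =
      filiformScale n s c d k * filiformCoeff n (fun _ => 1) (fun i => (-1) ^ i) i j k := by
  have hlast : ∀ i, 1 ≤ i → i + 1 ≤ n →
      filiformScale n s c d i * filiformScale n s c d (n - i) * d i =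
        (-1) ^ i * filiformScale n s c d n := by
    intro i hi
    induction i, hi using Nat.le_induction with
    | base =>
      intro _
      rw [filiformScale_one hn, filiformScale_self hn]
      ring
    | succ i hi ih =>
      intro h2
      have e := ih (by omega)
      obtain ⟨m, hm⟩ : ∃ m, n = m + i + 1 := ⟨n - i - 1, by omega⟩
      rw [show n - i = m + 1 by omega, filiformScale_succ (i := m) (by omega) (by omega)] at e
      rw [show n - (i + 1) = m by omega, filiformScale_succ hi (by omega), pow_succ]
      have hj := hJ i hi (by omega)
      rw [show n - 1 - i = m by omega] at hj
      linear_combination (s * filiformScale n s c d i * filiformScale n s c d m) * hj - e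
  by_cases h : FiliformTriple n i j k
  · rcases h with ⟨rfl, h1, h2, rfl⟩ | ⟨rfl, h1, h2, rfl⟩ | ⟨h1, h2, h3, rfl⟩
    · rw [filiformScale_succ h1 h2, filiformScale_zero]
      simp [filiformCoeff, h1, h2]
      ring
    · rw [filiformScale_succ h1 h2, filiformScale_zero]
      have : i ≠ 0 := by omega
      simp [filiformCoeff, h1, h2, this]
      ring
    · have hi : i ≠ 0 := by omega
      have hj : j ≠ 0 := by omega
      have e := hlast i h1 (by omega)
      rw [show k - i = j by omega] at e
      simp [filiformCoeff, h1, h2, h3, hi, hj]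
      rw [e]
      ring
  · have h0 : ∀ c d, filiformCoeff n c d i j k = 0 := fun c d => by
      by_contra hne
      exact h (.of_filiformCoeff_ne_zero hne)
    rw [h0, h0, mul_zero, mul_zero]

/-- Squared scales and model norms obey the same recursion, since `s ^ 2 = 1 / θ` cancels the factor
`θ` in `c i ^ 2` and `d 1 ^ 2`. -/
theorem filiformScale_sq (hn3 : 3 ≤ n) {θ : ℝ} (hθ : 0 < θ) (hs : s ^ 2 = 1 / θ)
    (hc : ∀ i, 1 ≤ i → i + 2 ≤ n → c i ^ 2 = θ * (i * (n - 1 - i)))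
    (hd : d 1 ^ 2 = θ * filiformBeta n) (i : ℕ) (hi : i ≤ n) :
    filiformScale n s c d i ^ 2 = 1 / θ * filiformNorm n i := by
  have hlt : ∀ i, 1 ≤ i → i + 1 ≤ n →
      filiformScale n s c d i ^ 2 = 1 / θ * filiformNorm n i := by
    intro i hi
    induction i, hi using Nat.le_induction with
    | base =>
      intro _
      rw [filiformScale_one (by omega), filiformNorm_one (by omega), hs, mul_one]
    | succ i hi ih =>
      intro h2
      rw [filiformScale_succ hi (by omega), filiformNorm_succ hi (by omega), mul_pow, mul_pow, hs,
        hc i hi (by omega), ih (by omega)]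
      field_simp
  rcases Nat.eq_zero_or_pos i with rfl | h0
  · rw [filiformScale_zero, filiformNorm_zero (by omega), hs, mul_one]
  rcases hi.lt_or_eq with h | rfl
  · exact hlt i h0 h
  · rw [filiformScale_self (by omega), filiformNorm_self h0, mul_pow, neg_sq, mul_pow, hs, hd,
      hlt (i - 1) (by omega) (by omega)]
    field_simp

end Rescaling

/-! ### Automorphisms from bases, and the model metric. -/

namespace FiliformQ

variable {n : ℕ} {hn : Odd n}

/-- The automorphism of `Q_n` given by a basis with the same structure constants. -/
noncomputable def equivOfBasis (Y : Module.Basis (Fin (n + 1)) ℝ (FiliformQ n hn))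
    (hY : ∀ i j k : Fin (n + 1), Y.repr ⁅Y i, Y j⁆ k =
      filiformCoeff n (fun _ => 1) (fun i => (-1) ^ i) i j k) :
    FiliformQ n hn ≃ₗ⁅ℝ⁆ FiliformQ n hn :=
  { (X n hn).equiv Y (Equiv.refl _) with
    map_lie' := by
      intro x y
      change (X n hn).equiv Y (Equiv.refl _) ⁅x, y⁆ =
        ⁅(X n hn).equiv Y (Equiv.refl _) x, (X n hn).equiv Y (Equiv.refl _) y⁆
      have h : ∀ z k, Y.repr ((X n hn).equiv Y (Equiv.refl _) z) k = (X n hn).repr z k := by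
        intro z k
        simp [Module.Basis.equiv]
      refine Y.ext_elem fun k => ?_
      rw [h, repr_lie_eq_sum, repr_lie_eq_sum]
      simp only [h, hY, X_repr_lie_eq_filiformCoeff] }

theorem equivOfBasis_apply (Y : Module.Basis (Fin (n + 1)) ℝ (FiliformQ n hn))
    (hY : ∀ i j k : Fin (n + 1), Y.repr ⁅Y i, Y j⁆ k =
      filiformCoeff n (fun _ => 1) (fun i => (-1) ^ i) i j k) (x : FiliformQ n hn) :
    equivOfBasis Y hY x = ∑ i, (X n hn).repr x i • Y i := by
  change (X n hn).equiv Y (Equiv.refl _) x = _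
  conv_lhs => rw [← (X n hn).sum_repr x]
  simp [-Module.Basis.sum_repr]

/-- The model nilsoliton metric on `Q_n`. -/
noncomputable def modelMetric (n : ℕ) (hn : Odd n) : LinearMap.BilinForm ℝ (FiliformQ n hn) :=
  ∑ i : Fin (n + 1), filiformNorm n i •
    (LinearMap.mul ℝ ℝ).compl₁₂ ((X n hn).coord i) ((X n hn).coord i)

theorem modelMetric_apply (x y : FiliformQ n hn) :
    modelMetric n hn x y =
      ∑ i : Fin (n + 1), filiformNorm n i * ((X n hn).repr x i * (X n hn).repr y i) := by
  simp [modelMetric, LinearMap.sum_apply]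

end FiliformQ

/-! ### Constraints on structure constants of the shape of `Q_n`. -/

theorem filiformCoeff_ne_zero {n : ℕ} {c d : ℕ → ℝ} (hc : ∀ i, c i ≠ 0) (hd : ∀ i, d i ≠ 0)
    {i j k : ℕ} (h : FiliformTriple n i j k) : filiformCoeff n c d i j k ≠ 0 := by
  rcases h with ⟨rfl, h1, h2, rfl⟩ | ⟨rfl, h1, h2, rfl⟩ | ⟨h1, h2, h3, rfl⟩
  · simp [filiformCoeff, h1, h2, hc]
  · have : i ≠ 0 := by omega
    simp [filiformCoeff, h1, h2, hc, this]
  · have hi : i ≠ 0 := by omega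
    have hj : j ≠ 0 := by omega
    simp [filiformCoeff, h1, h2, h3, hi, hj, hd]

/-- A skew family of structure constants supported on the triples of `Q_n` has the shape of
`filiformCoeff`. -/
theorem eq_filiformCoeff {n : ℕ} {μ : ℕ → ℕ → ℕ → ℝ} (hskew : ∀ i j k, μ i j k = -μ j i k)
    {i j k : ℕ} (h : μ i j k ≠ 0 → FiliformTriple n i j k) :
    μ i j k = filiformCoeff n (fun j => μ 0 j (j + 1)) (fun i => μ i (n - i) n) i j k := by
  by_cases ht : FiliformTriple n i j k
  · rcases ht with ⟨rfl, h1, h2, rfl⟩ | ⟨rfl, h1, h2, rfl⟩ | ⟨h1, h2, h3, rfl⟩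
    · simp [filiformCoeff, h1, h2]
    · have : i ≠ 0 := by omega
      simp [filiformCoeff, h1, h2, this]
      exact hskew _ _ _
    · have hi : i ≠ 0 := by omega
      have hj : j ≠ 0 := by omega
      simp [filiformCoeff, h1, h2, h3, hi, hj]
      rw [show k - i = j by omega]
  · rw [not_imp_comm.1 h ht]
    by_contra hne
    exact ht (.of_filiformCoeff_ne_zero (Ne.symm hne))

/-- The Jacobi identity for `Y 0`, `Y i`, `Y (n - 1 - i)`, of which the last two commute because
their indices add up to `n - 1`. -/
theorem filiform_jacobi {L : Type*} [LieRing L] [LieAlgebra ℝ L] {n : ℕ} {c d : ℕ → ℝ}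
    {Y : Module.Basis (Fin (n + 1)) ℝ L}
    (hY : ∀ i j k : Fin (n + 1), Y.repr ⁅Y i, Y j⁆ k = filiformCoeff n c d i j k)
    {i : ℕ} (h1 : 1 ≤ i) (h2 : i + 2 ≤ n) : c i * d (i + 1) = -(c (n - 1 - i) * d i) := by
  have hj := leibniz_lie (Y 0) (Y ⟨i, by omega⟩) (Y ⟨n - 1 - i, by omega⟩)
  rw [lie_eq_zero_of_filiformCoeff hY (i := ⟨i, by omega⟩) (j := ⟨n - 1 - i, by omega⟩)
      (fun k => by unfold FiliformTriple; dsimp only; omega), lie_zero,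
    lie_zero_of_filiformCoeff hY (i := 0) (j := ⟨i, by omega⟩) (k := ⟨i + 1, by omega⟩) rfl h1 h2
      rfl,
    lie_zero_of_filiformCoeff hY (i := 0) (j := ⟨n - 1 - i, by omega⟩) (k := ⟨n - i, by omega⟩) rfl
      (by dsimp only; omega) (by dsimp only; omega) (by dsimp only; omega), smul_lie, lie_smul,
    lie_last_of_filiformCoeff hY (i := ⟨i + 1, by omega⟩) (j := ⟨n - 1 - i, by omega⟩)
      (k := Fin.last n) (by dsimp only; omega) (by dsimp only; omega) (by dsimp only; omega) rfl,
    lie_last_of_filiformCoeff hY (i := ⟨i, by omega⟩) (j := ⟨n - i, by omega⟩)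
      (k := Fin.last n) h1 (by dsimp only; omega) (by dsimp only; omega) rfl,
    smul_smul, smul_smul, ← add_smul] at hj
  have := (smul_eq_zero.1 hj.symm).resolve_right (Y.ne_zero _)
  dsimp only at this
  linarith

/-- The structure constants of a nilsoliton metric in an adapted orthonormal basis. -/
theorem filiform_soliton_constants {L : Type*} [LieRing L] [LieAlgebra ℝ L] {n : ℕ} (hn3 : 3 ≤ n)
    {c d : ℕ → ℝ} {Q : LinearMap.BilinForm ℝ L} {E : Module.Basis (Fin (n + 1)) ℝ L}
    (hE : IsOrthonormalBasis Q E)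
    (hw : ∀ i j k : Fin (n + 1), Q ⁅E i, E j⁆ (E k) = filiformCoeff n c d i j k)
    (hc : ∀ i, 1 ≤ i → i + 2 ≤ n → c i ≠ 0) (hd : ∀ i, 1 ≤ i → i + 1 ≤ n → d i ≠ 0) {θ : ℝ}
    (hric : ∀ p : Fin (n + 1),
      nilRicciForm Q E (E p) (E p) = θ * (filiformWeight n p - filiformGamma n)) :
    (∀ k, 1 ≤ k → k + 1 ≤ n → d k ^ 2 = θ * filiformBeta n) ∧
      ∀ k, 1 ≤ k → k + 2 ≤ n → c k ^ 2 = θ * (k * (n - 1 - k)) := by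
  have hY : ∀ i j k : Fin (n + 1), E.repr ⁅E i, E j⁆ k = filiformCoeff n c d i j k :=
    fun i j k => (hE.repr_eq _ _).trans (hw i j k)
  have hA : ∀ i, 1 ≤ i → i + 2 ≤ n → filiformA n c i = c i ^ 2 := fun i h1 h2 => if_pos ⟨h1, h2⟩
  have hB : ∀ i, 1 ≤ i → i + 1 ≤ n → filiformB n d i = d i ^ 2 := fun i h1 h2 => if_pos ⟨h1, h2⟩
  -- Skew-symmetry of the bracket gives `d (n - i) = -d i`.
  have hsym : ∀ i, 1 ≤ i → i + 1 ≤ n → filiformB n d (n - i) = filiformB n d i := by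
    intro i h1 h2
    rw [hB i h1 h2, hB _ (by omega) (by omega)]
    have e1 := lie_last_of_filiformCoeff hY (i := ⟨i, by omega⟩) (j := ⟨n - i, by omega⟩)
      (k := Fin.last n) h1 (by dsimp only; omega) (by dsimp only; omega) rfl
    have e2 := lie_last_of_filiformCoeff hY (i := ⟨n - i, by omega⟩) (j := ⟨i, by omega⟩)
      (k := Fin.last n) (by dsimp only; omega) h1 (by dsimp only; omega) rfl
    rw [← lie_skew, e1, ← neg_smul] at e2
    have := smul_left_injective ℝ (E.ne_zero _) e2
    dsimp only at this
    rw [← this, neg_sq]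
  have h := filiform_eq_of_recurrence (a := filiformA n c) (b := filiformB n d) (θ := θ) hn3
    (if_neg (by omega)) (if_neg (by omega))
    (fun i h1 h2 => by rw [hA i h1 h2]; exact sq_pos_of_ne_zero (hc i h1 h2))
    (fun i h1 h2 => by rw [hB i h1 h2]; exact sq_pos_of_ne_zero (hd i h1 h2)) hsym
    (fun i h1 h2 => by
      have := filiform_jacobi hY h1 h2
      rw [hA i h1 h2, hA _ (by omega) (by omega), hB _ (by omega) (by omega),
        hB i h1 (by omega), ← mul_pow, this, neg_sq, mul_pow])
    (fun k h1 h2 => by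
      have := hric ⟨k, by omega⟩
      rw [nilRicciForm_filiform_mid hE hw h1 h2] at this
      dsimp only at this
      rw [hsym k h1 h2] at this
      linarith)
  exact ⟨fun k h1 h2 => by rw [← hB k h1 h2, h.1 k h1 h2],
    fun k h1 h2 => by rw [← hA k h1 h2, h.2 k h1 h2]⟩

/-! ### Uniqueness: reduction of a nilsoliton metric to the model. -/

namespace FiliformQ

variable {n : ℕ} {hn : Odd n}

/-- Every nilsoliton metric has an orthonormal basis with structure constants of the shape of
`Q_n`, in which the nil-Ricci form is diagonal with the pre-Einstein eigenvalues. -/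
theorem exists_orthonormal_filiform_basis (hn3 : 3 ≤ n)
    {Q : LinearMap.BilinForm ℝ (FiliformQ n hn)} (hQ : IsNilsolitonMetric Q) :
    ∃ (E : Module.Basis (Fin (n + 1)) ℝ (FiliformQ n hn)) (c d : ℕ → ℝ) (θ : ℝ),
      IsOrthonormalBasis Q E ∧ 0 < θ ∧
      (∀ i j k : Fin (n + 1), Q ⁅E i, E j⁆ (E k) = filiformCoeff n c d i j k) ∧
      (∀ i, 1 ≤ i → i + 2 ≤ n → c i ≠ 0) ∧ (∀ i, 1 ≤ i → i + 1 ≤ n → d i ≠ 0) ∧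
      ∀ p : Fin (n + 1),
        nilRicciForm Q E (E p) (E p) = θ * (filiformWeight n p - filiformGamma n) := by
  obtain ⟨⟨hs, hp⟩, β, D, b, hb, hR⟩ := hQ
  have hinj : Function.Injective fun i : Fin (n + 1) => filiformWeight n i := fun i j h =>
    Fin.ext (filiformWeight_injective hn hn3 (by omega) (by omega) h)
  obtain ⟨E, hE, h1, h2⟩ := exists_orthonormal_basis_triangular Q hs hp (X n hn)
    (fun i => filiformWeight n i) hinj
  have hE : IsOrthonormalBasis Q E := hE
  have hR' : ∀ x y, nilRicciForm Q E x y = β * Q x y + Q (D x) y := by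
    intro x y
    rw [nilRicciForm_eq_of_isOrthonormalBasis hE hb, ← hR]
    simp
  -- `D` differs from the symmetric Ricci endomorphism by a scalar.
  have hD : ∀ x y, Q (D.toLinearMap x) y = Q x (D.toLinearMap y) := by
    intro x y
    have e := nilRicciForm_symm Q hs E x y
    rw [hR', hR', hs x y, hs (D y) x] at e
    exact add_left_cancel e
  obtain ⟨δ, hδ⟩ := hE.exists_eigenvalues hinj h1 h2 hD
    (fun k j h => derivation_repr_eq_zero_of_weight_lt hn3 D h)
  have hδ : ∀ k, D (E k) = δ k • E k := hδ
  have hgr : ∀ i j k, (X n hn).repr ⁅X n hn i, X n hn j⁆ k ≠ 0 →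
      filiformWeight n k = filiformWeight n i + filiformWeight n j := fun i j k h =>
    (isFiliformWeight_filiformWeight n).of_triple (triple_of_repr_lie_ne_zero h)
  have hw0 : ∀ i j k : Fin (n + 1), FiliformTriple n i j k → Q ⁅E i, E j⁆ (E k) ≠ 0 := by
    intro i j k h
    rw [← hE.repr_eq]
    refine repr_lie_ne_zero hinj hgr h1 h2 ?_
    rw [X_repr_lie_eq_filiformCoeff]
    exact filiformCoeff_ne_zero (fun _ => one_ne_zero) (fun i => by simp) h
  -- The Leibniz rule for a derivation diagonal in `E`.
  have hwδ : ∀ i j k, Q ⁅E i, E j⁆ (E k) ≠ 0 → δ k = δ i + δ j := by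
    intro i j k h
    have e : Q (D ⁅E i, E j⁆) (E k) = Q ⁅E i, E j⁆ (D (E k)) := hD _ _
    rw [LieDerivation.apply_lie_eq_add, hδ, hδ, hδ, lie_smul, smul_lie, ← add_smul] at e
    simp only [map_smul, LinearMap.smul_apply, smul_eq_mul] at e
    rw [add_comm (δ i), mul_right_cancel₀ h e.symm]
  -- `Fin.ofNat` wraps around beyond `n`, but only indices at most `n` are used; likewise for `μ`
  -- below.
  let ψ : ℕ → ℝ := fun i => δ (Fin.ofNat (n + 1) i)
  have hψ : ∀ i : Fin (n + 1), ψ i = δ i := fun i => by simp [ψ]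
  have hψt : ∀ i j k, i ≤ n → j ≤ n → k ≤ n → FiliformTriple n i j k → ψ k = ψ i + ψ j := by
    intro i j k hi hj hk h
    have := hwδ ⟨i, by omega⟩ ⟨j, by omega⟩ ⟨k, by omega⟩ (hw0 _ _ _ h)
    rwa [← hψ, ← hψ, ← hψ] at this
  have hψw : IsFiliformWeight n ψ :=
    ⟨fun i h1 h2 => hψt 0 i (i + 1) (by omega) (by omega) (by omega)
        (Or.inl ⟨rfl, h1, h2, rfl⟩),
      fun i h1 h2 => hψt i (n - i) n (by omega) (by omega) le_rfl
        (Or.inr (Or.inr ⟨h1, by omega, by omega, rfl⟩))⟩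
  have hsum := hψw.sum_weight_mul hn3
  simp only [hψ] at hsum
  obtain ⟨θ, hθ, hβ, hδθ, hgraded⟩ := hE.weights_eq_smul (δ := δ) (β := β)
    (γ := filiformGamma n) (ω := fun i : Fin (n + 1) => filiformWeight n i)
    (fun k => by
      rw [hR', hδ, map_smul, LinearMap.smul_apply, hE k k, if_pos rfl, smul_eq_mul, mul_one,
        mul_one])
    hwδ
    (fun i j k h => le_of_repr_lie_ne_zero (ω := fun i : Fin (n + 1) => filiformWeight n i)
      hgr h1 h2 (by rwa [hE.repr_eq]))
    ⟨0, ⟨1, by omega⟩, ⟨2, by omega⟩, hw0 _ _ _ (Or.inl ⟨rfl, le_rfl, hn3, rfl⟩)⟩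
    (filiformGamma_pos hn3) hsum ((isFiliformWeight_filiformWeight n).sum_weight_mul hn3)
  let μ : ℕ → ℕ → ℕ → ℝ := fun i j k =>
    Q ⁅E (Fin.ofNat (n + 1) i), E (Fin.ofNat (n + 1) j)⁆ (E (Fin.ofNat (n + 1) k))
  have hμ : ∀ i j k : Fin (n + 1), μ i j k = Q ⁅E i, E j⁆ (E k) := fun i j k => by simp [μ]
  have hμ0 : ∀ i j k, i ≤ n → j ≤ n → k ≤ n → FiliformTriple n i j k → μ i j k ≠ 0 := by
    intro i j k hi hj hk h
    have := hw0 ⟨i, by omega⟩ ⟨j, by omega⟩ ⟨k, by omega⟩ h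
    rwa [← hμ] at this
  refine ⟨E, fun j => μ 0 j (j + 1), fun i => μ i (n - i) n, θ, hE, hθ, fun i j k => ?_,
    fun i h1 h2 => hμ0 _ _ _ (by omega) (by omega) (by omega) (Or.inl ⟨rfl, h1, h2, rfl⟩),
    fun i h1 h2 => hμ0 _ _ _ (by omega) (by omega) le_rfl
      (Or.inr (Or.inr ⟨h1, by omega, by omega, rfl⟩)), fun p => ?_⟩
  · rw [← hμ]
    refine eq_filiformCoeff (fun i j k => ?_) fun h => ?_
    · simp only [μ]
      rw [← lie_skew, map_neg, LinearMap.neg_apply]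
    · rw [hμ] at h
      refine .of_weight_eq hn hn3 (by omega) (by omega) (by omega) (fun hij => ?_)
        (hgraded i j k h)
      rw [Fin.ext hij, lie_self, map_zero] at h
      exact h rfl
  · rw [hR', hδ, map_smul, LinearMap.smul_apply, hE p p, if_pos rfl, hδθ, hβ, smul_eq_mul]
    ring

/-- Up to scaling and automorphisms, every nilsoliton metric on `Q_n` is the model metric. -/
theorem exists_lieEquiv_modelMetric (hn3 : 3 ≤ n)
    {Q : LinearMap.BilinForm ℝ (FiliformQ n hn)} (hQ : IsNilsolitonMetric Q) :
    ∃ (κ : ℝ) (φ : FiliformQ n hn ≃ₗ⁅ℝ⁆ FiliformQ n hn), 0 < κ ∧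
      ∀ x y, Q (φ x) (φ y) = κ * modelMetric n hn x y := by
  obtain ⟨E, c, d, θ, hE, hθ, hw, hc, hd, hric⟩ := exists_orthonormal_filiform_basis hn3 hQ
  obtain ⟨hd2, hc2⟩ := filiform_soliton_constants hn3 hE hw hc hd hric
  have hE' : ∀ i j k : Fin (n + 1), E.repr ⁅E i, E j⁆ k = filiformCoeff n c d i j k :=
    fun i j k => (hE.repr_eq _ _).trans (hw i j k)
  -- The common scale of `E_0` and `E_1`, chosen so that `filiformScale_sq` yields a multiple of the
  -- model norms.
  set s : ℝ := √(1 / θ) with hs_def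
  have hs : s ^ 2 = 1 / θ := Real.sq_sqrt (by positivity)
  have hs0 : s ≠ 0 := (Real.sqrt_pos.2 (by positivity)).ne'
  have hne := filiformScale_ne_zero (n := n) (d := d) (by omega) hs0 hc (hd 1 le_rfl (by omega))
  let Y := E.isUnitSMul (w := fun i => filiformScale n s c d i) fun i => (hne i).isUnit
  have hYE : ∀ i, Y i = filiformScale n s c d i • E i := fun i =>
    Module.Basis.isUnitSMul_apply _ i
  have hY : ∀ i j k : Fin (n + 1), Y.repr ⁅Y i, Y j⁆ k =
      filiformCoeff n (fun _ => 1) (fun i => (-1) ^ i) i j k := by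
    intro i j k
    have e := filiformScale_mul_filiformCoeff (s := s) (by omega)
      (fun i h1 h2 => filiform_jacobi hE' (i := i) h1 h2) (i : ℕ) j k
    rw [Module.Basis.repr_isUnitSMul, hYE, hYE, smul_lie, lie_smul, map_smul, map_smul,
      Finsupp.smul_apply, Finsupp.smul_apply, hE', Units.smul_def, Units.val_inv_eq_inv_val,
      IsUnit.unit_spec, smul_eq_mul, smul_eq_mul, smul_eq_mul, ← mul_assoc (filiformScale n s c d i),
      e, inv_mul_cancel_left₀ (hne k)]
  refine ⟨1 / θ, equivOfBasis Y hY, by positivity, fun x y => ?_⟩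
  rw [equivOfBasis_apply, equivOfBasis_apply, modelMetric_apply, Finset.mul_sum]
  simp only [hYE, smul_smul, map_sum, map_smul, LinearMap.sum_apply, LinearMap.smul_apply,
    hE _ _, smul_eq_mul, mul_ite, mul_one, mul_zero, Finset.sum_ite_eq', Finset.mem_univ, if_true]
  refine Finset.sum_congr rfl fun i _ => ?_
  have := filiformScale_sq hn3 hθ hs hc2 (hd2 1 le_rfl (by omega)) i (by omega)
  linear_combination ((X n hn).repr x i * (X n hn).repr y i) * this

end FiliformQ

/-! ### Existence: the model metric is a nilsoliton. -/

/-- The factor `j (n - 1 - j)` between consecutive norms is symmetric in `j ↦ n - 1 - j`, so what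
`i` gains in a step `n - i` loses. This is why all `modelD n i` have the same square. -/
theorem filiformNorm_mul {n : ℕ} {i : ℕ} (h1 : 1 ≤ i) (h2 : i + 1 ≤ n) :
    filiformNorm n i * filiformNorm n (n - i) = filiformNorm n (n - 1) := by
  induction i, h1 using Nat.le_induction with
  | base => rw [filiformNorm_one h2, one_mul]
  | succ i hi ih =>
    rw [← ih (by omega)]
    obtain ⟨m, hm⟩ : ∃ m, n = m + i + 1 := ⟨n - i - 1, by omega⟩
    rw [show n - i = m + 1 by omega, show n - (i + 1) = m by omega,
      filiformNorm_succ hi (by omega), filiformNorm_succ (i := m) (by omega) (by omega), hm]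
    push_cast
    ring

/-- The structure constants `c` of the model metric in its orthonormal basis. -/
noncomputable def modelC (n j : ℕ) : ℝ := √(filiformNorm n (j + 1)) / √(filiformNorm n j)

/-- The structure constants `d` of the model metric in its orthonormal basis. -/
noncomputable def modelD (n i : ℕ) : ℝ :=
  (-1) ^ i * (√(filiformNorm n n) / (√(filiformNorm n i) * √(filiformNorm n (n - i))))

theorem filiformA_modelC {n : ℕ} (hn3 : 3 ≤ n) {k : ℕ} (hk : k + 1 ≤ n) :
    filiformA n (modelC n) k = k * (n - 1 - k) := by
  unfold filiformA
  split_ifs with h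
  · have hp := filiformNorm_pos hn3
    rw [modelC, div_pow, Real.sq_sqrt (hp _).le, Real.sq_sqrt (hp _).le,
      filiformNorm_succ h.1 h.2, mul_div_assoc, div_self (hp k).ne', mul_one]
  -- At both ends the formula vanishes, in agreement with the extension by zero.
  · obtain rfl | h' : k = 0 ∨ n = k + 1 := by omega
    · simp
    · rw [h']
      push_cast
      ring

theorem filiformB_modelD {n : ℕ} (hn3 : 3 ≤ n) {k : ℕ} (h1 : 1 ≤ k) (h2 : k + 1 ≤ n) :
    filiformB n (modelD n) k = filiformBeta n := by
  have hp := filiformNorm_pos hn3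
  rw [filiformB, if_pos ⟨h1, h2⟩, modelD, mul_pow, div_pow, mul_pow, Real.sq_sqrt (hp _).le,
    Real.sq_sqrt (hp _).le, Real.sq_sqrt (hp _).le, filiformNorm_mul h1 h2,
    filiformNorm_self (by omega), mul_div_assoc, div_self (hp _).ne', mul_one, pow_right_comm,
    neg_one_sq, one_pow, one_mul]

theorem filiformCoeff_model {n : ℕ} (hn3 : 3 ≤ n) (i j k : ℕ) :
    √(filiformNorm n k) * filiformCoeff n (fun _ => 1) (fun i => (-1) ^ i) i j k =
      √(filiformNorm n i) * √(filiformNorm n j) *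
        filiformCoeff n (modelC n) (modelD n) i j k := by
  have hp : ∀ i, √(filiformNorm n i) ≠ 0 := fun i =>
    (Real.sqrt_pos.2 (filiformNorm_pos hn3 i)).ne'
  have h0 : √(filiformNorm n 0) = 1 := by rw [filiformNorm_zero (by omega), Real.sqrt_one]
  by_cases h : FiliformTriple n i j k
  · rcases h with ⟨rfl, h1, h2, rfl⟩ | ⟨rfl, h1, h2, rfl⟩ | ⟨h1, h2, h3, rfl⟩
    · simp only [filiformCoeff, h1, h2, and_self, if_true, h0, modelC]
      field_simp [hp j]
    · have : i ≠ 0 := by omega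
      simp only [filiformCoeff, h1, h2, this, false_and, if_false, and_self, if_true, h0, modelC]
      field_simp [hp i]
    · have hi : i ≠ 0 := by omega
      have hj : j ≠ 0 := by omega
      simp only [filiformCoeff, h1, h2, h3, hi, hj, false_and, if_false, and_self, if_true, modelD]
      rw [show k - i = j by omega]
      field_simp [hp i, hp j]
  · have h0 : ∀ c d, filiformCoeff n c d i j k = 0 := fun c d => by
      by_contra hne
      exact h (.of_filiformCoeff_ne_zero hne)
    rw [h0, h0, mul_zero, mul_zero]

/-- The nil-Ricci form is diagonal in an orthonormal basis whose structure constants are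
homogeneous with respect to distinct weights. -/
theorem IsOrthonormalBasis.nilRicciForm_eq_zero_of_ne {L ι : Type*} [LieRing L] [LieAlgebra ℝ L]
    [Fintype ι] [DecidableEq ι] {Q : LinearMap.BilinForm ℝ L} {E : Module.Basis ι ℝ L}
    (hE : IsOrthonormalBasis Q E) {ω : ι → ℝ} (hω : Function.Injective ω)
    (hw : ∀ i j k, Q ⁅E i, E j⁆ (E k) ≠ 0 → ω k = ω i + ω j) {p q : ι} (hpq : p ≠ q) :
    nilRicciForm Q E (E p) (E q) = 0 := by
  rw [nilRicciForm_basis hE, Finset.sum_eq_zero, Finset.sum_eq_zero, mul_zero, mul_zero, add_zero]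
  · refine fun i _ => Finset.sum_eq_zero fun j _ => ?_
    by_contra h
    have h1 := hw _ _ _ (left_ne_zero_of_mul h)
    have h2 := hw _ _ _ (right_ne_zero_of_mul h)
    exact hpq (hω (h1.trans h2.symm))
  · refine fun i _ => Finset.sum_eq_zero fun j _ => ?_
    by_contra h
    have h1 := hw _ _ _ (left_ne_zero_of_mul h)
    have h2 := hw _ _ _ (right_ne_zero_of_mul h)
    exact hpq (hω (by linarith))

/-- The entries with `p ≠ 0` are computed directly. The one at `p = 0` follows because both sides
have zero pairing with the weights, the left by homogeneity and the right by the pre-Einstein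
identity, and `X_0` has weight `1`. -/
theorem nilRicciForm_model {L : Type*} [LieRing L] [LieAlgebra ℝ L] {n : ℕ} (hn3 : 3 ≤ n)
    {Q : LinearMap.BilinForm ℝ L} {E : Module.Basis (Fin (n + 1)) ℝ L}
    (hE : IsOrthonormalBasis Q E)
    (hw : ∀ i j k : Fin (n + 1),
      Q ⁅E i, E j⁆ (E k) = filiformCoeff n (modelC n) (modelD n) i j k) (p : Fin (n + 1)) :
    nilRicciForm Q E (E p) (E p) = filiformWeight n p - filiformGamma n := by
  have hmid : ∀ p : Fin (n + 1), p ≠ 0 →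
      nilRicciForm Q E (E p) (E p) = filiformWeight n p - filiformGamma n := by
    intro p hp
    have hp0 : 1 ≤ (p : ℕ) := Nat.one_le_iff_ne_zero.2 fun h => hp (Fin.ext h)
    rcases (show (p : ℕ) ≤ n by omega).lt_or_eq with h | h
    · rw [nilRicciForm_filiform_mid hE hw hp0 h, filiformA_modelC hn3 (by omega),
        filiformA_modelC hn3 h, filiformB_modelD hn3 hp0 h, filiformB_modelD hn3 (by omega)
        (by omega), filiformWeight_of_lt hp0 h, Nat.cast_sub hp0]
      linear_combination -(1 / 2) * two_mul_filiformTau_sub n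
    · obtain rfl : p = Fin.last n := Fin.ext h
      rw [nilRicciForm_filiform_last (by omega) hE hw, Fin.val_last, filiformWeight_self (by omega)]
      obtain ⟨m, rfl⟩ : ∃ m, n = m + 1 := ⟨n - 1, by omega⟩
      have hB : ∑ i ∈ Finset.range (m + 1 + 1), filiformB (m + 1) (modelD (m + 1)) i =
          m * filiformBeta (m + 1) := by
        rw [Finset.sum_range_succ, Finset.sum_range_succ', Finset.sum_congr rfl fun i hi =>
          filiformB_modelD hn3 (by omega) (by have := Finset.mem_range.1 hi; omega)]
        simp [filiformB]
      have h2 := two_mul_filiformTau_sub (m + 1)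
      have h3 : filiformBeta (m + 1) * ((m + 1 : ℕ) + 3) = 4 * filiformGamma (m + 1) := by
        unfold filiformBeta
        field_simp
      rw [hB]
      push_cast at h2 h3 ⊢
      linear_combination (1 / 4) * h3 - h2
  rcases eq_or_ne p 0 with rfl | hp
  · have e1 : ∑ p : Fin (n + 1), filiformWeight n p * nilRicciForm Q E (E p) (E p) = 0 := by
      rw [sum_mul_nilRicciForm hE fun p : Fin (n + 1) => filiformWeight n p]
      refine mul_eq_zero_of_right _ (Finset.sum_eq_zero fun i _ => Finset.sum_eq_zero fun j _ =>
        Finset.sum_eq_zero fun k _ => ?_)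
      by_cases h : filiformCoeff n (modelC n) (modelD n) i j k = 0
      · rw [hw, h]
        ring
      · rw [(isFiliformWeight_filiformWeight n).of_triple (.of_filiformCoeff_ne_zero h)]
        ring
    have e2 : ∑ p : Fin (n + 1), filiformWeight n p * (filiformWeight n p - filiformGamma n) =
        0 := by
      simp only [mul_sub, Finset.sum_sub_distrib, ← Finset.sum_mul]
      rw [(isFiliformWeight_filiformWeight n).sum_weight_mul hn3]
      ring
    rw [← e2, ← Finset.add_sum_erase _ _ (Finset.mem_univ 0),
      ← Finset.add_sum_erase _ (fun p : Fin (n + 1) => filiformWeight n p * _)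
        (Finset.mem_univ 0),
      Finset.sum_congr rfl fun p hp => by rw [hmid p (Finset.ne_of_mem_erase hp)]] at e1
    have := add_right_cancel e1
    rwa [Fin.val_zero, filiformWeight_zero, one_mul, one_mul] at this
  · exact hmid p hp

namespace FiliformQ

variable {n : ℕ} {hn : Odd n}

/-- The diagonal derivation of `Q_n` with eigenvalues `ψ`. -/
noncomputable def diagDerivation (n : ℕ) (hn : Odd n) (ψ : ℕ → ℝ) (hψ : IsFiliformWeight n ψ) :
    LieDerivation ℝ (FiliformQ n hn) (FiliformQ n hn) where
  toLinearMap := (X n hn).constr ℝ fun i => ψ i • X n hn i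
  leibniz' a b := by
    have hrepr : ∀ (z : FiliformQ n hn) (k : Fin (n + 1)),
        (X n hn).repr ((X n hn).constr ℝ (fun i : Fin (n + 1) => ψ i • X n hn i) z) k =
          ψ k * (X n hn).repr z k := by
      intro z k
      rw [repr_map_eq_sum (X n hn) (X n hn), Finset.sum_eq_single k]
      · simp [mul_comm]
      · intro i _ hi
        simp [Finsupp.single_eq_of_ne hi.symm]
      · simp
    rw [← lie_skew b, sub_neg_eq_add]
    refine (X n hn).ext_elem fun k => ?_
    rw [hrepr, map_add, Finsupp.add_apply, repr_lie_eq_sum, repr_lie_eq_sum, repr_lie_eq_sum,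
      Finset.mul_sum, ← Finset.sum_add_distrib]
    refine Finset.sum_congr rfl fun i _ => ?_
    rw [Finset.mul_sum, ← Finset.sum_add_distrib]
    refine Finset.sum_congr rfl fun j _ => ?_
    rw [hrepr, hrepr]
    by_cases h : (X n hn).repr ⁅X n hn i, X n hn j⁆ k = 0
    · rw [h]
      ring
    · rw [hψ.of_triple (triple_of_repr_lie_ne_zero h)]
      ring

theorem diagDerivation_X (ψ : ℕ → ℝ) (hψ : IsFiliformWeight n ψ) (i : Fin (n + 1)) :
    diagDerivation n hn ψ hψ (X n hn i) = ψ i • X n hn i :=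
  (X n hn).constr_basis ℝ _ i

/-- In the normalized basis the Ricci form is diagonal because the weights are distinct, and its
eigenvalues `ω p - γ` exhibit it as `-γ` plus the pre-Einstein derivation. -/
theorem isNilsolitonMetric_modelMetric (hn3 : 3 ≤ n) : IsNilsolitonMetric (modelMetric n hn) := by
  have hp := filiformNorm_pos hn3
  have hs : ∀ i, √(filiformNorm n i) ≠ 0 := fun i => (Real.sqrt_pos.2 (hp i)).ne'
  let E := (X n hn).isUnitSMul (w := fun i => (√(filiformNorm n i))⁻¹)
    fun i => (inv_ne_zero (hs i)).isUnit
  have hEX : ∀ i, E i = (√(filiformNorm n i))⁻¹ • X n hn i := fun i =>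
    Module.Basis.isUnitSMul_apply _ i
  have hXX : ∀ (z : FiliformQ n hn) (j : Fin (n + 1)),
      modelMetric n hn z (X n hn j) = filiformNorm n j * (X n hn).repr z j := by
    intro z j
    rw [modelMetric_apply, Finset.sum_eq_single j]
    · simp
    · intro k _ hk
      simp [Finsupp.single_eq_of_ne hk]
    · simp
  have hE : IsOrthonormalBasis (modelMetric n hn) E := by
    intro i j
    rw [hEX, hEX, map_smul, map_smul, LinearMap.smul_apply, hXX, Module.Basis.repr_self]
    rcases eq_or_ne i j with rfl | hij
    · rw [if_pos rfl, Finsupp.single_eq_same, smul_eq_mul, smul_eq_mul, mul_one]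
      have := Real.mul_self_sqrt (hp i).le
      field_simp [hs i]
      rw [pow_two, this]
    · rw [if_neg hij, Finsupp.single_eq_of_ne hij.symm]
      simp
  have hw : ∀ i j k : Fin (n + 1), modelMetric n hn ⁅E i, E j⁆ (E k) =
      filiformCoeff n (modelC n) (modelD n) i j k := by
    intro i j k
    rw [hEX, hEX, hEX, map_smul, hXX, smul_lie, lie_smul, map_smul, map_smul,
      Finsupp.smul_apply, Finsupp.smul_apply, X_repr_lie_eq_filiformCoeff]
    simp only [smul_eq_mul]
    have e := filiformCoeff_model hn3 (i : ℕ) j k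
    have h1 : (√(filiformNorm n k))⁻¹ * filiformNorm n k = √(filiformNorm n k) := by
      rw [inv_mul_eq_iff_eq_mul₀ (hs k), Real.mul_self_sqrt (hp k).le]
    have hi := hs i
    have hj := hs j
    calc _ = (√(filiformNorm n i))⁻¹ * (√(filiformNorm n j))⁻¹ *
          (((√(filiformNorm n k))⁻¹ * filiformNorm n k) *
            filiformCoeff n (fun _ => 1) (fun i => (-1) ^ i) i j k) := by ring
      _ = _ := by
        rw [h1, e]
        field_simp
  have hinj : Function.Injective fun i : Fin (n + 1) => filiformWeight n i := fun i j h =>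
    Fin.ext (filiformWeight_injective hn hn3 (by omega) (by omega) h)
  have hψ := isFiliformWeight_filiformWeight n
  have hDE : ∀ i, diagDerivation n hn _ hψ (E i) = filiformWeight n i • E i := by
    intro i
    rw [hEX, map_smul, diagDerivation_X, smul_comm]
  refine ⟨⟨hE.symm, fun x hx => ?_⟩, -filiformGamma n, diagDerivation n hn _ hψ, ?_⟩
  · rw [modelMetric_apply]
    obtain ⟨i, hi⟩ : ∃ i, (X n hn).repr x i ≠ 0 := by
      by_contra! h
      exact hx ((X n hn).ext_elem fun i => by rw [h i, map_zero, Finsupp.zero_apply])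
    exact Finset.sum_pos' (fun i _ => mul_nonneg (hp i).le (mul_self_nonneg _))
      ⟨i, Finset.mem_univ _, mul_pos (hp i) (mul_self_pos.2 hi)⟩
  · have hcard : n + 1 = Module.finrank ℝ (FiliformQ n hn) := by
      rw [Module.finrank_eq_card_basis E, Fintype.card_fin]
    have hb : IsOrthonormalBasis (modelMetric n hn) (E.reindex (finCongr hcard)) := by
      intro i j
      rw [Module.Basis.reindex_apply, Module.Basis.reindex_apply, hE]
      simp
    refine ⟨E.reindex (finCongr hcard), hb, fun x y => ?_⟩
    rw [nilRicciForm_eq_of_isOrthonormalBasis hb hE]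
    have : (modelMetric n hn).comp
        (-filiformGamma n • LinearMap.id + (diagDerivation n hn _ hψ).toLinearMap)
        LinearMap.id = nilRicciBilin (modelMetric n hn) E := by
      refine LinearMap.BilinForm.ext_basis E fun p q => ?_
      change modelMetric n hn (-filiformGamma n • E p + diagDerivation n hn _ hψ (E p)) (E q) =
        nilRicciForm (modelMetric n hn) E (E p) (E q)
      rw [hDE, ← add_smul, map_smul, LinearMap.smul_apply, hE, smul_eq_mul]
      rcases eq_or_ne p q with rfl | hpq
      · rw [nilRicciForm_model hn3 hE hw, if_pos rfl]
        ring
      · rw [if_neg hpq, mul_zero, hE.nilRicciForm_eq_zero_of_ne hinj _ hpq]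
        intro i j k h
        rw [hw] at h
        exact hψ.of_triple (.of_filiformCoeff_ne_zero h)
    exact congrArg (fun B : LinearMap.BilinForm ℝ (FiliformQ n hn) => B x y) this

end FiliformQ

theorem mainTheorem6 (n : ℕ) (hn : Odd n) (hn3 : 3 ≤ n) :
    (∃ Q : LinearMap.BilinForm ℝ (FiliformQ n hn), IsNilsolitonMetric Q) ∧
    ∀ Q Q' : LinearMap.BilinForm ℝ (FiliformQ n hn),
      IsNilsolitonMetric Q → IsNilsolitonMetric Q' →
      ∃ (c : ℝ) (φ : FiliformQ n hn ≃ₗ⁅ℝ⁆ FiliformQ n hn),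
        0 < c ∧ ∀ x y, Q' x y = c * Q (φ x) (φ y) := by
  refine ⟨⟨_, FiliformQ.isNilsolitonMetric_modelMetric hn3⟩, fun Q Q' hQ hQ' => ?_⟩
  obtain ⟨κ, φ, hκ, h⟩ := FiliformQ.exists_lieEquiv_modelMetric hn3 hQ
  obtain ⟨κ', φ', hκ', h'⟩ := FiliformQ.exists_lieEquiv_modelMetric hn3 hQ'
  -- Pass from `Q'` to the model by `φ'.symm` and from the model to `Q` by `φ`.
  refine ⟨κ' / κ, φ'.symm.trans φ, div_pos hκ' hκ, fun x y => ?_⟩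
  have e := h' (φ'.symm x) (φ'.symm y)
  rw [LieEquiv.apply_symm_apply, LieEquiv.apply_symm_apply] at e
  rw [LieEquiv.trans_apply, LieEquiv.trans_apply, h, e]
  field_simp
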